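/- Let $(M^m,g_M)$ be a connected smooth Riemannian manifold of dimension $m$ and let $(N^n,g_N)$ be a non-empty smooth Riemannian manifold of dimension $n\ge 1$ (both without boundary). Assume that $(M,g_M)$ is Einstein with $\mathrm{Ricci}^M=a\,g_M$ for a real constant $a$, and let $\lambda:M\to\mathbb{R}$ be a smooth function. Consider the projection of the warped product onto its first factor, $$\phi:\bigl(M\times N,\ g_M+e^{2\lambda}g_N\bigr)\longrightarrow (M,g_M),\qquad \phi(x,y)=x .$$ Then $\phi$ is a biharmonic map if and only if there is a constant $C\in\mathbb{R}$ such that $$\Delta\lambda+2a\lambda+\frac n2\,|\mathrm{grad}\,\lambda|^2=C\quad\text{on } M,$$ where $\mathrm{grad}$ and $\Delta$ (the trace of the Hessian) are the gradient and the Laplace operator of $(M,g_M)$. Here a smooth map $\phi:(P,g)\to(M,h)$ is biharmonic if it satisfies the biharmonic map equation $$\mathrm{Trace}_g\bigl(\nabla^\phi\nabla^\phi-\nabla^\phi_{\nabla^P}\bigr)\tau(\phi)-\mathrm{Trace}_g\,R^M(d\phi,\tau(\phi))\,d\phi=0,\qquad \tau(\phi)=\mathrm{Trace}_g\nabla d\phi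 ,$$ where $\nabla^\phi$ is the pull-back connection on $\phi^{-1}TM$ and $R^M(X,Y)Z=[\nabla^M_X,\nabla^M_Y]Z-\nabla^M_{[X,Y]}Z$. -/

import Mathlib

open Bundle Module
open scoped Manifold ContDiff Bundle

noncomputable section

/-! ### Riemannian geometry in coordinates

`E` is a coordinate space with basis `b` (so that `∂_i` is the derivative in direction `b i`), and
`G : E → Matrix ι ι ℝ` is the matrix `(g_{ij})` of a metric in these coordinates. -/

namespace RiemCoord

section

variable {E : Type*} [NormedAddCommGroup E] [NormedSpace ℝ E]
  {ι : Type*} [Fintype ι] [DecidableEq ι] (b : Basis ι ℝ E)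

/-- The partial derivative `∂_i f`. -/
def pderiv (i : ι) (f : E → ℝ) (y : E) : ℝ := fderiv ℝ f y (b i)

/-- The Christoffel symbol
`Γ^k_{ij} = (1/2) ∑_l g^{kl} (∂_i g_{jl} + ∂_j g_{il} - ∂_l g_{ij})` of the Levi-Civita
connection. -/
def christoffel (G : E → Matrix ι ι ℝ) (k i j : ι) (y : E) : ℝ :=
  (1 / 2) * ∑ l, (G y)⁻¹ k l *
    (pderiv b i (fun z => G z j l) y + pderiv b j (fun z => G z i l) y
      - pderiv b l (fun z => G z i j) y)

/-- The components of the curvature `R(X,Y)Z = [∇_X, ∇_Y] Z - ∇_{[X,Y]} Z`: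
`R(∂_i, ∂_j) ∂_k = ∑_l (curvature b G l k i j) ∂_l`. -/
def curvature (G : E → Matrix ι ι ℝ) (l k i j : ι) (y : E) : ℝ :=
  pderiv b i (christoffel b G l j k) y - pderiv b j (christoffel b G l i k) y
    + ∑ s, (christoffel b G l i s y * christoffel b G s j k y
      - christoffel b G l j s y * christoffel b G s i k y)

/-- The Ricci tensor `Ric(∂_j, ∂_k) = trace (X ↦ R(X, ∂_j) ∂_k)`. -/
def ricci (G : E → Matrix ι ι ℝ) (j k : ι) (y : E) : ℝ :=
  ∑ i, curvature b G i k i j y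

/-- The Laplace operator `Δf = ∑ g^{ij} (∂_i ∂_j f - ∑_k Γ^k_{ij} ∂_k f)` (trace of the
Hessian). -/
def laplacian (G : E → Matrix ι ι ℝ) (f : E → ℝ) (y : E) : ℝ :=
  ∑ i, ∑ j, (G y)⁻¹ i j *
    (pderiv b i (pderiv b j f) y - ∑ k, christoffel b G k i j y * pderiv b k f y)

variable {E' : Type*} [NormedAddCommGroup E'] [NormedSpace ℝ E']
  {κ : Type*} [Fintype κ] [DecidableEq κ] (c : Basis κ ℝ E')

/-- The component `u^α` of a map `u` between coordinate spaces. -/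
def comp (u : E → E') (α : κ) (y : E) : ℝ := c.repr (u y) α

/-- The pull-back connection: the component `α` of `∇^u_{∂_i} V`, where
`V = ∑ V^α ∂_α` is a vector field along `u` and `K` is the metric of the target:
`(∇^u_i V)^α = ∂_i V^α + ∑ Γ^α_{βγ}(u) ∂_i u^β V^γ`. -/
def nablaAlong (K : E' → Matrix κ κ ℝ) (u : E → E') (i : ι) (V : κ → E → ℝ)
    (α : κ) (y : E) : ℝ :=
  pderiv b i (V α) y +
    ∑ β, ∑ γ, christoffel c K α β γ (u y) * pderiv b i (comp c u β) y * V γ y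

/-- The component `α` of the tension field `τ(u) = Trace_g ∇du`, where
`(∇du)(∂_i, ∂_j) = ∇^u_{∂_i} (du ∂_j) - du(∇_{∂_i} ∂_j)`. -/
def tension (G : E → Matrix ι ι ℝ) (K : E' → Matrix κ κ ℝ) (u : E → E')
    (α : κ) (y : E) : ℝ :=
  ∑ i, ∑ j, (G y)⁻¹ i j *
    (nablaAlong b c K u i (fun β => pderiv b j (comp c u β)) α y
      - ∑ k, christoffel b G k i j y * pderiv b k (comp c u α) y)

/-- The component `α` of `Trace_g (∇^u ∇^u - ∇^u_∇) V` for a vector field `V` along `u`. -/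
def traceNablaSq (G : E → Matrix ι ι ℝ) (K : E' → Matrix κ κ ℝ) (u : E → E')
    (V : κ → E → ℝ) (α : κ) (y : E) : ℝ :=
  ∑ i, ∑ j, (G y)⁻¹ i j *
    (nablaAlong b c K u i (nablaAlong b c K u j V) α y
      - ∑ k, christoffel b G k i j y * nablaAlong b c K u k V α y)

/-- The component `α` of the bitension field
`τ₂(u) = Trace_g (∇^u ∇^u - ∇^u_∇) τ(u) - Trace_g R(du, τ(u)) du`. -/
def bitension (G : E → Matrix ι ι ℝ) (K : E' → Matrix κ κ ℝ) (u : E → E')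
    (α : κ) (y : E) : ℝ :=
  traceNablaSq b c G K u (tension b c G K u) α y
    - ∑ i, ∑ j, (G y)⁻¹ i j * ∑ β, ∑ γ, ∑ δ,
        curvature c K α δ β γ (u y) * pderiv b i (comp c u β) y *
          tension b c G K u γ y * pderiv b j (comp c u δ) y

end

end RiemCoord

/-! ### Riemannian manifolds

`M` is a smooth manifold without boundary modelled on `E` through `I`, and `b` is a basis of `E`:
the components of `extChartAt I p` in the basis `b` are local coordinates around `p`. All tensor
quantities at `p` are computed in the chart `extChartAt I p` preferred at `p`, through which
`TangentSpace I p` is identified with `E` by definition. -/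

section

variable {E : Type*} [NormedAddCommGroup E] [NormedSpace ℝ E]
  {H : Type*} [TopologicalSpace H] {I : ModelWithCorners ℝ E H}
  {M : Type*} [TopologicalSpace M] [ChartedSpace H M]

variable (I M) in
/-- Smooth Riemannian metrics on the manifold `M`. -/
abbrev RiemannianMetricOn [IsManifold I ∞ M] : Type _ :=
  ContMDiffRiemannianMetric I ∞ E (TangentSpace I : M → Type _)

variable [IsManifold I ∞ M]

variable {ι : Type*} [Fintype ι] [DecidableEq ι] (b : Basis ι ℝ E) (g : RiemannianMetricOn I M)

/-- The vector `b i` of the basis `b`, as a tangent vector at `p`. -/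
def basisVec (p : M) (i : ι) : TangentSpace I p := b i

/-- The coordinate vector field `∂_i` of the chart at `p`, at the point with coordinates `y`. -/
def coordVec (p : M) (y : E) (i : ι) : TangentSpace I ((extChartAt I p).symm y) :=
  mfderiv 𝓘(ℝ, E) I (extChartAt I p).symm y (basisVec (I := 𝓘(ℝ, E)) b y i)

/-- The matrix `g_{ij} = g(∂_i, ∂_j)` of `g` in the chart at `p`, as a function of the
coordinates. -/
def metricCoord (p : M) (y : E) : Matrix ι ι ℝ :=
  Matrix.of fun i j =>
    g.inner ((extChartAt I p).symm y) (coordVec (I := I) b p y i) (coordVec (I := I) b p y j)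

/-- The differential of a function `f : M → ℝ` at `p`. -/
def differential (f : M → ℝ) (p : M) (v : TangentSpace I p) : ℝ :=
  mfderiv I 𝓘(ℝ, ℝ) f p v

/-- The gradient of `f`: `(grad f)(p) = ∑ g^{ij} df(b_j) b_i`, where `(g^{ij})` is the inverse of
the Gram matrix of the basis `b` of `T_p M`. -/
def riemGradient (f : M → ℝ) (p : M) : TangentSpace I p :=
  ∑ i, ∑ j, ((Matrix.of fun k l =>
      g.inner p (basisVec (I := I) b p k) (basisVec (I := I) b p l))⁻¹ i j *
    differential (I := I) f p (basisVec (I := I) b p j)) • basisVec (I := I) b p i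

/-- The squared norm `|grad f|²`. -/
def gradientNormSq (f : M → ℝ) (p : M) : ℝ := g.inner p (riemGradient b g f p) (riemGradient b g f p)

/-- The Laplace operator on functions, `Δf = trace_g (∇df)`. -/
def laplaceBeltrami (f : M → ℝ) (p : M) : ℝ :=
  RiemCoord.laplacian b (metricCoord b g p) (f ∘ (extChartAt I p).symm) (extChartAt I p p)

/-- The Ricci tensor `Ric_p(v, w)`. -/
def ricciTensor (p : M) (v w : TangentSpace I p) : ℝ :=
  ∑ j, ∑ k, RiemCoord.ricci b (metricCoord b g p) j k (extChartAt I p p) *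
    b.repr v j * b.repr w k

/-- `Ric = a g` for the constant `a`. -/
def IsEinsteinWith (a : ℝ) : Prop :=
  ∀ (p : M) (v w : TangentSpace I p), ricciTensor b g p v w = a * g.inner p v w

variable {E' : Type*} [NormedAddCommGroup E'] [NormedSpace ℝ E']
  {H' : Type*} [TopologicalSpace H'] {I' : ModelWithCorners ℝ E' H'}
  {M' : Type*} [TopologicalSpace M'] [ChartedSpace H' M'] [IsManifold I' ∞ M']
  {κ : Type*} [Fintype κ] [DecidableEq κ] (c : Basis κ ℝ E') (h : RiemannianMetricOn I' M')

/-- The bitension field of `φ : (M, g) → (M', h)`, a section of `φ⁻¹ TM'`. -/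
def bitensionField (φ : M → M') (p : M) : TangentSpace I' (φ p) :=
  ∑ α, RiemCoord.bitension b c (metricCoord b g p) (metricCoord c h (φ p))
    (writtenInExtChartAt I I' p φ) α (extChartAt I p p) • basisVec (I := I') c (φ p) α

/-- Biharmonic maps between Riemannian manifolds: smooth solutions of the biharmonic map equation
`τ₂(φ) = 0`. -/
def IsBiharmonicMap (φ : M → M') : Prop :=
  ContMDiff I I' ∞ φ ∧ ∀ p, bitensionField b g c h φ p = 0

end

/-! ### Warped products -/

section

variable {E : Type*} [NormedAddCommGroup E] [NormedSpace ℝ E]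
  {H : Type*} [TopologicalSpace H] {I : ModelWithCorners ℝ E H}
  {M : Type*} [TopologicalSpace M] [ChartedSpace H M] [IsManifold I ∞ M]
  {F : Type*} [NormedAddCommGroup F] [NormedSpace ℝ F]
  {K : Type*} [TopologicalSpace K] {J : ModelWithCorners ℝ F K}
  {N : Type*} [TopologicalSpace N] [ChartedSpace K N] [IsManifold J ∞ N]

/-- The pull-back `(v, w) ↦ B (A v) (A w)` of a bilinear form. -/
def pullbackForm {V W : Type*} [AddCommGroup V] [Module ℝ V] [TopologicalSpace V]
    [AddCommGroup W] [Module ℝ W] [TopologicalSpace W]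
    (B : W →L[ℝ] W →L[ℝ] ℝ) (A : V →L[ℝ] W) : V →L[ℝ] V →L[ℝ] ℝ :=
  (ContinuousLinearMap.precomp ℝ A) ∘L B ∘L A

/-- The bilinear form `π_M^* g_M + e^{2 f} π_N^* g_N` on the tangent space of `M × N` at `p`. -/
def warpedInner (gM : RiemannianMetricOn I M) (gN : RiemannianMetricOn J N) (f : M → ℝ)
    (p : M × N) :
    TangentSpace (I.prod J) p →L[ℝ] TangentSpace (I.prod J) p →L[ℝ] ℝ :=
  pullbackForm (gM.inner p.1) (mfderiv (I.prod J) I (Prod.fst : M × N → M) p)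
    + Real.exp (2 * f p.1) •
      pullbackForm (gN.inner p.2) (mfderiv (I.prod J) J (Prod.snd : M × N → N) p)

theorem warpedInner_apply (gM : RiemannianMetricOn I M) (gN : RiemannianMetricOn J N) (f : M → ℝ)
    (p : M × N) (v w : TangentSpace (I.prod J) p) :
    warpedInner gM gN f p v w =
      gM.inner p.1 (mfderiv (I.prod J) I (Prod.fst : M × N → M) p v)
          (mfderiv (I.prod J) I (Prod.fst : M × N → M) p w)
        + Real.exp (2 * f p.1) *
          gN.inner p.2 (mfderiv (I.prod J) J (Prod.snd : M × N → N) p v)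
            (mfderiv (I.prod J) J (Prod.snd : M × N → N) p w) := rfl

theorem contMDiffAt_clm_of_apply {E : Type*} [NormedAddCommGroup E] [NormedSpace ℝ E]
    {H : Type*} [TopologicalSpace H] {I : ModelWithCorners ℝ E H}
    {M : Type*} [TopologicalSpace M] [ChartedSpace H M] {V W : Type*} [NormedAddCommGroup V] [NormedSpace ℝ V]
    [FiniteDimensional ℝ V] [NormedAddCommGroup W] [NormedSpace ℝ W]
    (u : M → V →L[ℝ] W) (p : M) (hu : ∀ v, ContMDiffAt I 𝓘(ℝ, W) ∞ (fun x => u x v) p) :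
    ContMDiffAt I 𝓘(ℝ, V →L[ℝ] W) ∞ u p := by
  have hd : finrank ℝ V = finrank ℝ (Fin (finrank ℝ V) → ℝ) := (finrank_fin_fun ℝ).symm
  let e₁ := ContinuousLinearEquiv.ofFinrankEq hd
  let e₂ := (e₁.arrowCongr (1 : W ≃L[ℝ] W)).trans
    (ContinuousLinearEquiv.piRing (Fin (finrank ℝ V)))
  have h2 : ContMDiffAt I 𝓘(ℝ, Fin (finrank ℝ V) → W) ∞ (fun x => e₂ (u x)) p :=
    contMDiffAt_pi_space.mpr fun i => hu _
  have h3 := (e₂.symm.contDiff (n := ∞)).contMDiff.contMDiffAt.comp p h2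
  refine h3.congr_of_eventuallyEq (Filter.Eventually.of_forall fun x => ?_)
  simp


theorem tangent_prod_ext {M N : Type*} [TopologicalSpace M] [ChartedSpace H M]
    [TopologicalSpace N] [ChartedSpace K N] (p : M × N) (v : TangentSpace (I.prod J) p)
    (h1 : mfderiv (I.prod J) I (Prod.fst : M × N → M) p v = 0)
    (h2 : mfderiv (I.prod J) J (Prod.snd : M × N → N) p v = 0) : v = 0 := by
  rw [mfderiv_fst] at h1
  rw [mfderiv_snd] at h2
  exact Prod.ext h1 h2

theorem metric_nonneg (g : RiemannianMetricOn I M) (p : M) (v : TangentSpace I p) :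
    0 ≤ g.inner p v v := by
  by_cases hv : v = 0
  · simp [hv]
  · exact (g.pos p v hv).le

theorem warpedInner_bounded (gM : RiemannianMetricOn I M) (gN : RiemannianMetricOn J N)
    (f : M → ℝ) (p : M × N) :
    Bornology.IsVonNBounded ℝ
      {v : TangentSpace (I.prod J) p | warpedInner gM gN f p v v < 1} := by
  let i1 : TangentSpace I p.1 →L[ℝ] TangentSpace (I.prod J) p := ContinuousLinearMap.inl ℝ E F
  let i2 : TangentSpace J p.2 →L[ℝ] TangentSpace (I.prod J) p :=
    Real.exp (-f p.1) • (ContinuousLinearMap.inr ℝ E F :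
      TangentSpace J p.2 →L[ℝ] TangentSpace (I.prod J) p)
  refine (((gM.isVonNBounded p.1).image i1).add ((gN.isVonNBounded p.2).image i2)).subset ?_
  intro v hv
  have hv' : warpedInner gM gN f p v v < 1 := hv
  rw [warpedInner_apply] at hv'
  have e1 := metric_nonneg gM p.1 (mfderiv (I.prod J) I (Prod.fst : M × N → M) p v)
  have e2 := mul_nonneg (Real.exp_pos (2 * f p.1)).le
    (metric_nonneg gN p.2 (mfderiv (I.prod J) J (Prod.snd : M × N → N) p v))
  refine Set.mem_add.mpr ⟨_, ⟨mfderiv (I.prod J) I (Prod.fst : M × N → M) p v, ?_, rfl⟩, _,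
    ⟨Real.exp (f p.1) • mfderiv (I.prod J) J (Prod.snd : M × N → N) p v, ?_, rfl⟩, ?_⟩
  · exact lt_of_le_of_lt (by linarith) hv'
  · have : gN.inner p.2 (Real.exp (f p.1) • mfderiv (I.prod J) J (Prod.snd : M × N → N) p v)
        (Real.exp (f p.1) • mfderiv (I.prod J) J (Prod.snd : M × N → N) p v)
        = Real.exp (2 * f p.1) * gN.inner p.2 (mfderiv (I.prod J) J (Prod.snd : M × N → N) p v)
          (mfderiv (I.prod J) J (Prod.snd : M × N → N) p v) := by
      rw [two_mul, Real.exp_add]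
      simp only [map_smul, smul_apply, smul_eq_mul]
      ring
    exact lt_of_le_of_lt (by rw [this]; linarith) hv'
  · have hs : Real.exp (-f p.1) * Real.exp (f p.1) = 1 := by
      rw [← Real.exp_add]; simp
    have h2 : i2 (Real.exp (f p.1) • mfderiv (I.prod J) J (Prod.snd : M × N → N) p v) =
        (ContinuousLinearMap.inr ℝ E F : TangentSpace J p.2 →L[ℝ] TangentSpace (I.prod J) p)
          (mfderiv (I.prod J) J (Prod.snd : M × N → N) p v) := by
      rw [map_smul]
      change Real.exp (f p.1) • Real.exp (-f p.1) •
        (ContinuousLinearMap.inr ℝ E F : TangentSpace J p.2 →L[ℝ] TangentSpace (I.prod J) p) _ = _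
      rw [smul_smul, mul_comm, hs, one_smul]
    rw [h2, mfderiv_fst, mfderiv_snd]
    exact Prod.ext (add_zero _) (zero_add _)

theorem warpedInner_contMDiff [FiniteDimensional ℝ E] [FiniteDimensional ℝ F]
    (gM : RiemannianMetricOn I M) (gN : RiemannianMetricOn J N) (f : M → ℝ)
    (hf : ContMDiff I 𝓘(ℝ, ℝ) ∞ f) :
    ContMDiff (I.prod J) ((I.prod J).prod 𝓘(ℝ, (E × F) →L[ℝ] (E × F) →L[ℝ] ℝ)) ∞
      (fun p => TotalSpace.mk' ((E × F) →L[ℝ] (E × F) →L[ℝ] ℝ)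
        (E := fun p : M × N => TangentSpace (I.prod J) p →L[ℝ] TangentSpace (I.prod J) p →L[ℝ] ℝ)
        p (warpedInner gM gN f p)) := by
  intro p₀
  refine (contMDiffAt_hom_bundle _).2 ⟨contMDiffAt_id, ?_⟩
  refine contMDiffAt_clm_of_apply _ _ fun v => contMDiffAt_clm_of_apply _ _ fun w => ?_
  let t := trivializationAt (E × F) (TangentSpace (I.prod J) : M × N → Type _) p₀
  have hp₀ : p₀ ∈ t.baseSet := mem_baseSet_trivializationAt _ _ _
  have hsec : ∀ v : E × F, ContMDiffAt (I.prod J) (I.prod J).tangent ∞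
      (fun p => (⟨p, t.symm p v⟩ : TangentBundle (I.prod J) (M × N))) p₀ := by
    intro v
    have hs : ContMDiffAt ((I.prod J).prod 𝓘(ℝ, E × F)) (I.prod J).tangent ∞
        t.toOpenPartialHomeomorph.symm (p₀, v) :=
      (t.contMDiffOn_symm (IB := I.prod J) (n := ∞)).contMDiffAt
        (t.open_target.mem_nhds (by simpa [t.mem_target] using hp₀))
    have hc : ContMDiffAt (I.prod J) ((I.prod J).prod 𝓘(ℝ, E × F)) ∞
        (fun p : M × N => (p, v)) p₀ := contMDiffAt_id.prodMk contMDiffAt_const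
    refine (ContMDiffAt.comp p₀ hs hc).congr_of_eventuallyEq ?_
    filter_upwards [t.open_baseSet.mem_nhds hp₀] with p hp
    exact t.mk_symm hp v
  have h1 : ∀ v : E × F, ContMDiffAt (I.prod J) I.tangent ∞
      (fun p : M × N => (⟨p.1, mfderiv (I.prod J) I (Prod.fst : M × N → M) p (t.symm p v)⟩ :
        TangentBundle I M)) p₀ := fun v =>
    ContMDiffAt.comp p₀ ((contMDiff_fst (n := ∞)).contMDiff_tangentMap (m := ∞) le_rfl _) (hsec v)
  have h2 : ∀ v : E × F, ContMDiffAt (I.prod J) J.tangent ∞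
      (fun p : M × N => (⟨p.2, mfderiv (I.prod J) J (Prod.snd : M × N → N) p (t.symm p v)⟩ :
        TangentBundle J N)) p₀ := fun v =>
    ContMDiffAt.comp p₀ ((contMDiff_snd (n := ∞)).contMDiff_tangentMap (m := ∞) le_rfl _) (hsec v)
  have k1 : ContMDiffAt (I.prod J) 𝓘(ℝ, ℝ) ∞ (fun p : M × N =>
      gM.inner p.1 (mfderiv (I.prod J) I (Prod.fst : M × N → M) p (t.symm p v))
        (mfderiv (I.prod J) I (Prod.fst : M × N → M) p (t.symm p w))) p₀ := by
    have : ContMDiffAt (I.prod J) (I.prod 𝓘(ℝ)) ∞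
        (fun p : M × N => TotalSpace.mk' ℝ (E := Bundle.Trivial M ℝ) p.1
          (gM.inner p.1 (mfderiv (I.prod J) I (Prod.fst : M × N → M) p (t.symm p v))
            (mfderiv (I.prod J) I (Prod.fst : M × N → M) p (t.symm p w)))) p₀ := by
      apply ContMDiffAt.clm_bundle_apply₂ (F₁ := E) (F₂ := E)
      · exact ContMDiffAt.comp p₀ gM.contMDiff.contMDiffAt contMDiffAt_fst
      · exact h1 v
      · exact h1 w
    exact (contMDiffAt_totalSpace.1 this).2
  have k2 : ContMDiffAt (I.prod J) 𝓘(ℝ, ℝ) ∞ (fun p : M × N =>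
      gN.inner p.2 (mfderiv (I.prod J) J (Prod.snd : M × N → N) p (t.symm p v))
        (mfderiv (I.prod J) J (Prod.snd : M × N → N) p (t.symm p w))) p₀ := by
    have : ContMDiffAt (I.prod J) (J.prod 𝓘(ℝ)) ∞
        (fun p : M × N => TotalSpace.mk' ℝ (E := Bundle.Trivial N ℝ) p.2
          (gN.inner p.2 (mfderiv (I.prod J) J (Prod.snd : M × N → N) p (t.symm p v))
            (mfderiv (I.prod J) J (Prod.snd : M × N → N) p (t.symm p w)))) p₀ := by
      apply ContMDiffAt.clm_bundle_apply₂ (F₁ := F) (F₂ := F)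
      · exact ContMDiffAt.comp p₀ gN.contMDiff.contMDiffAt contMDiffAt_snd
      · exact h2 v
      · exact h2 w
    exact (contMDiffAt_totalSpace.1 this).2
  have k3 : ContMDiffAt (I.prod J) 𝓘(ℝ, ℝ) ∞ (fun p : M × N => Real.exp (2 * f p.1)) p₀ := by
    have hf' : ContMDiffAt (I.prod J) 𝓘(ℝ, ℝ) ∞ (fun p : M × N => f p.1) p₀ :=
      ContMDiffAt.comp p₀ hf.contMDiffAt contMDiffAt_fst
    have he : ContDiff ℝ ∞ (fun x : ℝ => Real.exp (2 * x)) := by fun_prop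
    exact ContMDiffAt.comp (g := fun x : ℝ => Real.exp (2 * x)) p₀ he.contMDiff.contMDiffAt hf'
  refine (k1.add (k3.mul k2)).congr_of_eventuallyEq ?_
  filter_upwards [t.open_baseSet.mem_nhds hp₀] with p hp
  rw [inCoordinates_apply_eq₂ hp hp (by simp)]
  simp [warpedInner_apply]
  rfl

/-- The warped product metric `g_M + e^{2 f} g_N` on `M × N`, with warping function `e^f`. -/
def warpedMetric [FiniteDimensional ℝ E] [FiniteDimensional ℝ F]
    (gM : RiemannianMetricOn I M) (gN : RiemannianMetricOn J N) (f : M → ℝ)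
    (hf : ContMDiff I 𝓘(ℝ, ℝ) ∞ f) : RiemannianMetricOn (I.prod J) (M × N) where
  inner p := warpedInner gM gN f p
  symm p v w := by
    rw [warpedInner_apply, warpedInner_apply, gM.symm, gN.symm]
  pos p v hv := by
    rw [warpedInner_apply]
    by_cases h1 : mfderiv (I.prod J) I (Prod.fst : M × N → M) p v = 0
    · have h2 : mfderiv (I.prod J) J (Prod.snd : M × N → N) p v ≠ 0 :=
        fun h2 => hv (tangent_prod_ext p v h1 h2)
      exact add_pos_of_nonneg_of_pos (metric_nonneg gM _ _)
        (mul_pos (Real.exp_pos _) (gN.pos _ _ h2))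
    · exact add_pos_of_pos_of_nonneg (gM.pos _ _ h1)
        (mul_nonneg (Real.exp_pos _).le (metric_nonneg gN _ _))
  isVonNBounded p := warpedInner_bounded gM gN f p
  contMDiff := warpedInner_contMDiff gM gN f hf

end

/-- The standard basis of `ℝ^m`. -/
def stdBasis (m : ℕ) : Basis (Fin m) ℝ (EuclideanSpace ℝ (Fin m)) :=
  (EuclideanSpace.basisFun (Fin m) ℝ).toBasis

end

/-! ### Algebra of a Levi-Civita connection over a ring with commuting derivations -/

noncomputable section

/-! Write f for the warping exponent λ. In a product chart the warped metric is block diagonal with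
blocks G and e^{2f} K. The fibre directions have Christoffel symbols -e^{2f} K_{ij} (grad f)^k with
base upper index (`christoffel_warped_inr`). The base block is totally geodesic for the projection,
so tracing over the fibre gives τ(φ) = n grad f (`tension_warped`).

This field is pulled back from M. Along such fields the pull-back connection is ∇ in base directions
and zero in fibre directions. Hence the base trace of the second derivative is the rough Laplacian
of n grad f, and the fibre trace survives only through the Christoffel term, as n ∇_{grad f}(n grad
f). With the curvature term, where Einstein gives Trace R(·, X)· = -a X, the bitension field is n
(Trace ∇² grad f + n ∇_{grad f} grad f + a grad f).

Two identities turn the bracket into a gradient. Bochner's formula (`rough_laplacian_grad`) gives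
Trace ∇² grad f = grad Δf + a grad f, and symmetry of the Hessian gives ∇_{grad f} grad f = ½ grad
|grad f|² (`two_mul_nabla_grad_grad`). So τ₂(φ) = n grad(Δf + 2af + (n/2)|grad f|²)
(`gradVec_potential`, `bitension_warped`). As n ≠ 0, biharmonicity means that this potential has
zero differential, which on a connected M means that it is constant.

Two devices carry the formalization. The tensor identities are proved for abstract commuting
derivations of a commutative ring (`ConnectionData`), where no differentiability has to be checked,
and are then evaluated at points of an open set. Moreover Δf and |grad f|² are defined at each point
in that point's own chart, so differentiating the potential requires their invariance under
coordinate changes (`laplacian_comp`, `gradSq_comp`, `manifoldPotential_eqOn`). -/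

theorem Matrix.map_derivation_mul {ι R : Type*} [Fintype ι] [CommRing R] [Algebra ℝ R]
    (D : Derivation ℝ R R) (A B : Matrix ι ι R) :
    (A * B).map D = A.map D * B + A * B.map D := by
  ext j k
  simp only [Matrix.map_apply, Matrix.mul_apply, map_sum, Derivation.leibniz, smul_eq_mul,
    Matrix.add_apply, ← Finset.sum_add_distrib]
  exact Finset.sum_congr rfl fun s _ => by ring

/-- The algebra of a Levi-Civita connection in coordinates: commuting derivations `D i` of a ring of
functions, a symmetric matrix `G` with inverse `P`, and the connection matrices
`Γ i = (Γ^k_{ij})_{k,j}`, torsion free and compatible with `G`. -/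
structure ConnectionData (ι R : Type*) [Fintype ι] [DecidableEq ι] [CommRing R] [Algebra ℝ R] where
  D : ι → Derivation ℝ R R
  G : Matrix ι ι R
  P : Matrix ι ι R
  Γ : ι → Matrix ι ι R
  D_comm : ∀ i j x, D i (D j x) = D j (D i x)
  G_symm : G.transpose = G
  G_mul_P : G * P = 1
  torsion : ∀ i j k, Γ i k j = Γ j k i
  compat : ∀ i, G.map (D i) = (Γ i).transpose * G + G * Γ i

namespace ConnectionData

variable {ι R : Type*} [Fintype ι] [DecidableEq ι] [CommRing R] [Algebra ℝ R]
  (c : ConnectionData ι R)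

theorem P_mul_G : c.P * c.G = 1 := mul_eq_one_comm.mp c.G_mul_P

theorem P_transpose : c.P.transpose = c.P := by
  have h : c.P.transpose * c.G = 1 := by
    have := congrArg Matrix.transpose c.G_mul_P
    rwa [Matrix.transpose_mul, c.G_symm, Matrix.transpose_one] at this
  calc c.P.transpose = c.P.transpose * (c.G * c.P) := by rw [c.G_mul_P, mul_one]
    _ = c.P := by rw [← mul_assoc, h, one_mul]

theorem P_symm (i j : ι) : c.P i j = c.P j i := congrFun (congrFun c.P_transpose j) i

/-- Differentiating P G = 1 gives ∂P = -P (∂G) P; metric compatibility then replaces ∂G. This says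
that the inverse metric is parallel. -/
theorem map_D_P (i : ι) :
    c.P.map (c.D i) = -(c.Γ i * c.P) - c.P * (c.Γ i).transpose := by
  have h := Matrix.map_derivation_mul (c.D i) c.P c.G
  have h0 : (c.P * c.G).map (c.D i) = 0 := by
    rw [c.P_mul_G]
    ext j k
    by_cases hjk : j = k <;> simp [hjk]
  rw [h0, c.compat] at h
  have h1 : c.P.map (c.D i) * c.G = -(c.P * ((c.Γ i).transpose * c.G + c.G * c.Γ i)) :=
    eq_neg_of_add_eq_zero_left h.symm
  calc c.P.map (c.D i) = c.P.map (c.D i) * c.G * c.P := by rw [mul_assoc, c.G_mul_P, mul_one]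
    _ = -(c.P * (c.Γ i).transpose * (c.G * c.P)) - (c.P * c.G) * c.Γ i * c.P := by
      rw [h1]; noncomm_ring
    _ = _ := by rw [c.G_mul_P, c.P_mul_G]; noncomm_ring

theorem D_P (i j k : ι) :
    c.D i (c.P j k) = -∑ s, c.Γ i j s * c.P s k - ∑ s, c.P j s * c.Γ i k s := by
  have := congrFun (congrFun (c.map_D_P i) j) k
  simpa [Matrix.mul_apply] using this

/-- The curvature matrices: `riem i j l k` is the component `l` of `R(∂_i, ∂_j) ∂_k`. -/
def riem (i j : ι) : Matrix ι ι R :=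
  (c.Γ j).map (c.D i) - (c.Γ i).map (c.D j) + (c.Γ i * c.Γ j - c.Γ j * c.Γ i)

/-- Expand both sides of D_j D_i G = D_i D_j G by applying compatibility twice. The terms symmetric
in i and j cancel, and what is left is the skewness of the curvature endomorphism. -/
theorem riem_skew (i j : ι) : (c.riem i j).transpose * c.G + c.G * c.riem i j = 0 := by
  have hadd : ∀ k (A B : Matrix ι ι R), (A + B).map (c.D k) = A.map (c.D k) + B.map (c.D k) :=
    fun k A B => by ext; simp
  have hT : ∀ k (A : Matrix ι ι R), A.transpose.map (c.D k) = (A.map (c.D k)).transpose :=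
    fun k A => rfl
  have h : (c.G.map (c.D i)).map (c.D j) = (c.G.map (c.D j)).map (c.D i) := by
    ext k l
    exact c.D_comm _ _ _
  simp only [c.compat, hadd, Matrix.map_derivation_mul, hT] at h
  simp only [riem, Matrix.transpose_add, Matrix.transpose_sub, Matrix.transpose_mul]
  rw [← sub_eq_zero] at h
  rw [← neg_eq_zero, ← h]
  noncomm_ring

theorem riem_mul_P (i j : ι) : c.riem i j * c.P = -(c.P * (c.riem i j).transpose) := by
  have h := eq_neg_of_add_eq_zero_right (c.riem_skew i j)
  calc c.riem i j * c.P = c.P * (c.G * c.riem i j) * c.P := by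
        rw [← mul_assoc, c.P_mul_G, one_mul]
    _ = -(c.P * (c.riem i j).transpose * (c.G * c.P)) := by rw [h]; noncomm_ring
    _ = _ := by rw [c.G_mul_P, mul_one]

/-- `∑ P^{ij} R(∂_i, ∂_γ) ∂_j`, component `α`. -/
def traceRiem (α γ : ι) : R := ∑ i, ∑ j, c.P i j * c.riem i γ α j

/-- Skewness moves the contraction from the last slot to the upper index. The inner sum on the right
is the Ricci tensor, so the trace in the biharmonic equation is minus the Ricci endomorphism. -/
theorem traceRiem_eq (α γ : ι) :
    c.traceRiem α γ = -∑ k, c.P α k * ∑ i, c.riem i γ i k := by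
  have h : ∀ i, ∑ j, c.P i j * c.riem i γ α j = -∑ k, c.P α k * c.riem i γ i k := fun i => by
    have := congrFun (congrFun (c.riem_mul_P i γ) α) i
    simp only [Matrix.mul_apply, Matrix.neg_apply, Matrix.transpose_apply] at this
    rw [← this]
    exact Finset.sum_congr rfl fun j _ => by rw [c.P_symm i j, mul_comm]
  simp only [traceRiem, h, Finset.mul_sum, Finset.sum_neg_distrib]
  rw [Finset.sum_comm]

/-- The components of `∇_{∂_i} X` for a vector field `X`. -/
def nabla (i : ι) (X : ι → R) (α : ι) : R := c.D i (X α) + ∑ γ, c.Γ i α γ * X γ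

/-- The components of `∇_{∂_i} w` for a `1`-form `w`. -/
def conabla (i : ι) (w : ι → R) (k : ι) : R := c.D i (w k) - ∑ s, c.Γ i s k * w s

/-- Raising an index commutes with ∇ because the inverse metric is parallel; the two Christoffel
terms of `D_P` supply the cancellation and the sign change. -/
theorem nabla_sharp (i : ι) (w : ι → R) (α : ι) :
    c.nabla i (fun β => ∑ k, c.P β k * w k) α = ∑ k, c.P α k * c.conabla i w k := by
  simp only [nabla, conabla, map_sum, Derivation.leibniz, smul_eq_mul, c.D_P, mul_sub, mul_neg,
    Finset.sum_add_distrib, Finset.sum_sub_distrib, Finset.sum_neg_distrib, Finset.mul_sum]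
  have h1 : ∑ x, ∑ k, w x * (c.Γ i α k * c.P k x) = ∑ x, ∑ k, c.Γ i α x * (c.P x k * w k) := by
    rw [Finset.sum_comm]
    exact Finset.sum_congr rfl fun _ _ => Finset.sum_congr rfl fun _ _ => by ring
  have h2 : ∑ x, ∑ k, w x * (c.P α k * c.Γ i x k) = ∑ x, ∑ k, c.P α x * (c.Γ i k x * w k) := by
    rw [Finset.sum_comm]
    exact Finset.sum_congr rfl fun _ _ => Finset.sum_congr rfl fun _ _ => by ring
  rw [h1, h2]
  ring

/-- The Ricci identity on 1-forms. The indices i and j only label coordinate directions, and since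
[∂_i, ∂_j] = 0 no further term appears. -/
theorem conabla_conabla_sub (i j : ι) (w : ι → R) (k : ι) :
    c.conabla i (c.conabla j w) k - c.conabla j (c.conabla i w) k = -∑ s, c.riem i j s k * w s := by
  simp only [riem, conabla, map_sum, map_sub, Derivation.leibniz, smul_eq_mul, mul_sub, sub_mul,
    add_mul, Matrix.add_apply, Matrix.sub_apply, Matrix.map_apply, Matrix.mul_apply,
    Finset.sum_add_distrib, Finset.sum_sub_distrib, Finset.mul_sum, Finset.sum_mul]
  rw [c.D_comm j i]
  have h : ∀ i j, ∑ x, ∑ s, c.Γ i x k * (c.Γ j s x * w s)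
      = ∑ x, ∑ s, c.Γ j x s * c.Γ i s k * w x := fun i j => by
    rw [Finset.sum_comm]
    exact Finset.sum_congr rfl fun _ _ => Finset.sum_congr rfl fun _ _ => by ring
  rw [h i j, h j i]
  simp only [mul_comm (w _)]
  ring

/-- The components of `df`. -/
def diff (f : R) (i : ι) : R := c.D i f

/-- The components of the gradient of `f`. -/
def grad (f : R) (α : ι) : R := ∑ k, c.P α k * c.D k f

theorem conabla_diff_symm (f : R) (i j : ι) :
    c.conabla i (c.diff f) j = c.conabla j (c.diff f) i := by
  simp only [conabla, diff, c.D_comm j i, c.torsion i j]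

theorem nabla_grad (f : R) (i : ι) :
    c.nabla i (c.grad f) = fun α => ∑ k, c.P α k * c.conabla i (c.diff f) k :=
  funext fun α => c.nabla_sharp i (c.diff f) α

/-- The Laplacian. -/
def lap (f : R) : R := ∑ i, ∑ j, c.P i j * c.conabla i (c.diff f) j

/-- Compatibility gives ∂_k |grad f|² = 2⟨∇_k grad f, grad f⟩ = 2 Hess f(∂_k, grad f), and symmetry
of the Hessian exchanges the two arguments. -/
theorem two_mul_nabla_grad_grad (f : R) (α : ι) :
    2 * ∑ i, c.grad f i * c.nabla i (c.grad f) α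
      = ∑ k, c.P α k * c.D k (∑ i, ∑ j, c.P i j * c.D i f * c.D j f) := by
  have h : ∀ k, c.D k (∑ i, ∑ j, c.P i j * c.D i f * c.D j f)
      = 2 * ∑ i, c.grad f i * c.conabla i (c.diff f) k := fun k => by
    have h1 : ∑ i, ∑ j, c.P i j * c.D i f * c.D j f = ∑ i, c.grad f i * c.D i f := by
      rw [Finset.sum_congr rfl fun i _ => ?_]
      rw [grad, Finset.sum_mul]
      exact Finset.sum_congr rfl fun _ _ => by ring
    have h2 : ∑ i, c.D i f * c.nabla k (c.grad f) i
        = ∑ i, c.grad f i * c.conabla k (c.diff f) i := by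
      simp only [nabla_grad]
      simp only [grad, Finset.mul_sum, Finset.sum_mul]
      rw [Finset.sum_comm]
      exact Finset.sum_congr rfl fun _ _ => Finset.sum_congr rfl fun _ _ => by
        rw [c.P_symm]; ring
    have h3 : ∑ i, c.D i f * c.nabla k (c.grad f) i
        = ∑ i, c.D i f * c.D k (c.grad f i) + ∑ i, c.D i f * ∑ s, c.Γ k i s * c.grad f s := by
      simp only [nabla, mul_add, Finset.sum_add_distrib]
    have h4 : ∑ i, c.D i f * ∑ s, c.Γ k i s * c.grad f s
        = ∑ i, c.grad f i * c.D k (c.D i f) - ∑ i, c.grad f i * c.conabla k (c.diff f) i := by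
      simp only [conabla, mul_sub, Finset.sum_sub_distrib, diff, Finset.mul_sum]
      rw [sub_sub_cancel, Finset.sum_comm]
      exact Finset.sum_congr rfl fun _ _ => Finset.sum_congr rfl fun _ _ => by ring
    simp only [h1, map_sum, Derivation.leibniz, smul_eq_mul, Finset.sum_add_distrib]
    simp only [fun i => c.conabla_diff_symm f i k]
    linear_combination h2 - h3 - h4
  simp only [h]
  simp only [nabla_grad, Finset.mul_sum]
  rw [Finset.sum_comm]
  exact Finset.sum_congr rfl fun _ _ => Finset.sum_congr rfl fun _ _ => by ring

/-- This is Bochner's formula with the index lowered. Compatibility lets the derivative pass through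
the trace of the Hessian. Exchanging the direction l with a traced direction uses the symmetry of
the Hessian and the Ricci identity, whose curvature term is the last sum. -/
theorem D_lap (f : R) (l : ι) :
    c.D l (c.lap f) = ∑ i, ∑ j, c.P i j * (c.conabla i (c.conabla j (c.diff f)) l
      - ∑ k, c.Γ i k j * c.conabla k (c.diff f) l) + ∑ s, c.traceRiem s l * c.D s f := by
  set H : ι → ι → R := fun i => c.conabla i (c.diff f) with hH
  have hsymm : ∀ i j, H i j = H j i := c.conabla_diff_symm f
  have h0 : c.D l (c.lap f) = ∑ i, ∑ j, c.P i j * c.conabla l (H i) j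
      - ∑ i, ∑ j, c.P i j * ∑ s, c.Γ l s i * H s j := by
    have : ∀ i, c.D l (∑ j, c.P i j * H i j)
        = ∑ j, c.P i j * c.conabla l (H i) j - ∑ s, c.Γ l i s * ∑ j, c.P s j * H i j := fun i => by
      rw [← c.nabla_sharp l (H i) i, nabla, add_sub_cancel_right]
    simp only [lap, map_sum (c.D l) _ Finset.univ] at this ⊢
    rw [Finset.sum_congr rfl fun i _ => this i, Finset.sum_sub_distrib]
    congr 1
    simp only [Finset.mul_sum]
    rw [Finset.sum_comm]
    refine Finset.sum_congr rfl fun i _ => ?_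
    rw [Finset.sum_comm]
    exact Finset.sum_congr rfl fun _ _ => Finset.sum_congr rfl fun _ _ => by ring
  have h1 : ∀ i j, c.conabla l (H i) j = c.conabla i (H j) l + ∑ s, c.Γ i s l * H s j
      - ∑ k, c.Γ i k j * H k l + ∑ s, c.riem i l s j * c.D s f := fun i j => by
    have e1 := c.conabla_conabla_sub i l (c.diff f) j
    have e2 : c.conabla i (H l) j = c.conabla i (H j) l + ∑ s, c.Γ i s l * H s j
        - ∑ k, c.Γ i k j * H k l := by
      simp only [conabla, hsymm l, fun s => hsymm s j]
      ring
    simp only [diff] at e1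
    linear_combination e2 - e1
  have h2 : ∑ s, c.traceRiem s l * c.D s f
      = ∑ i, ∑ j, c.P i j * ∑ s, c.riem i l s j * c.D s f := by
    simp only [traceRiem, Finset.sum_mul, Finset.mul_sum]
    rw [Finset.sum_comm]
    refine Finset.sum_congr rfl fun i _ => ?_
    rw [Finset.sum_comm]
    exact Finset.sum_congr rfl fun _ _ => Finset.sum_congr rfl fun _ _ => by ring
  rw [h0, h2]
  simp only [h1, ← Finset.sum_sub_distrib, ← Finset.sum_add_distrib]
  refine Finset.sum_congr rfl fun i _ => Finset.sum_congr rfl fun j _ => ?_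
  simp only [c.torsion l i]
  ring

/-- The Bochner formula for the rough Laplacian of a gradient. -/
theorem rough_laplacian_grad (f : R) (α : ι) :
    ∑ i, ∑ j, c.P i j * (c.nabla i (c.nabla j (c.grad f)) α
        - ∑ k, c.Γ i k j * c.nabla k (c.grad f) α)
      = ∑ k, c.P α k * (c.D k (c.lap f) - ∑ s, c.traceRiem s k * c.D s f) := by
  -- The curvature term from `D_lap` cancels the one subtracted on the right; only a rearrangement
  -- of finite sums remains.
  simp only [nabla_grad, c.nabla_sharp, c.D_lap, add_sub_cancel_right]
  simp only [mul_sub, Finset.mul_sum, Finset.sum_sub_distrib]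
  congr 1
  · conv_rhs => rw [Finset.sum_comm]
    refine Finset.sum_congr rfl fun i _ => ?_
    rw [Finset.sum_comm]
    exact Finset.sum_congr rfl fun _ _ => Finset.sum_congr rfl fun _ _ => by ring
  · conv_rhs => rw [Finset.sum_comm]
    refine Finset.sum_congr rfl fun i _ => ?_
    conv_rhs => rw [Finset.sum_comm]
    refine Finset.sum_congr rfl fun j _ => ?_
    rw [Finset.sum_comm]
    exact Finset.sum_congr rfl fun _ _ => Finset.sum_congr rfl fun _ _ => by ring

end ConnectionData

namespace ConnectionData

variable {ι R : Type*} [Fintype ι] [DecidableEq ι] [CommRing R] [Algebra ℝ R]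

/-- The Levi-Civita connection of a symmetric invertible matrix. -/
def ofMetric (D : ι → Derivation ℝ R R) (hD : ∀ i j x, D i (D j x) = D j (D i x))
    (G P : Matrix ι ι R) (hG : G.transpose = G) (hP : G * P = 1) : ConnectionData ι R where
  D := D
  G := G
  P := P
  Γ i := Matrix.of fun k j =>
    (1 / 2 : ℝ) • ∑ l, P k l * (D i (G j l) + D j (G i l) - D l (G i j))
  D_comm := hD
  G_symm := hG
  G_mul_P := hP
  torsion i j k := by
    have h : ∀ i j, G i j = G j i := fun i j => congrFun (congrFun hG j) i
    simp only [Matrix.of_apply, h j i]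
    congr 1
    exact Finset.sum_congr rfl fun _ _ => by ring
  compat i := by
    have h : ∀ i j, G i j = G j i := fun i j => congrFun (congrFun hG j) i
    -- Lowering the upper index with G removes P from the Christoffel formula. The two lowered
    -- symbols then add up to one derivative of G, the other four terms cancelling in pairs.
    have key : ∀ k (v : ι → R), ∑ s, G k s * ((1 / 2 : ℝ) • ∑ l, P s l * v l)
        = (1 / 2 : ℝ) • v k := fun k v => by
      simp only [mul_smul_comm, ← Finset.smul_sum, Finset.mul_sum]
      rw [Finset.sum_comm]
      have : ∀ l, ∑ s, G k s * (P s l * v l) = (1 : Matrix ι ι R) k l * v l := fun l => by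
        rw [← hP, Matrix.mul_apply, Finset.sum_mul]
        exact Finset.sum_congr rfl fun _ _ => by ring
      simp [this, Matrix.one_apply]
    ext j k
    simp only [Matrix.map_apply, Matrix.add_apply, Matrix.mul_apply, Matrix.transpose_apply,
      Matrix.of_apply]
    simp only [h _ k, mul_comm _ (G k _)]
    rw [key k, key j, ← smul_add, h k j, h k i, h i j]
    rw [show D i (G j k) + D j (G i k) - D k (G j i) + (D i (G j k) + D k (G j i) - D j (G i k))
      = (2 : ℝ) • D i (G j k) by rw [two_smul]; ring, smul_smul]
    norm_num

end ConnectionData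

/-! ### The ring of functions smooth on an open set, and its directional derivations -/

section SmoothFunctions

variable {E : Type*} [NormedAddCommGroup E] [NormedSpace ℝ E]

/-- Functions which are smooth on the set `U`. -/
def smoothOn (U : Set E) : Subalgebra ℝ (E → ℝ) where
  carrier := {f | ContDiffOn ℝ ∞ f U}
  mul_mem' hf hg := ContDiffOn.mul hf hg
  add_mem' hf hg := ContDiffOn.add hf hg
  algebraMap_mem' _ := contDiffOn_const

variable {U : Set E} (hU : IsOpen U)

include hU in
theorem ContDiffOn.fderiv_apply_const {f : E → ℝ} (hf : ContDiffOn ℝ ∞ f U) (v : E) :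
    ContDiffOn ℝ ∞ (fun y => fderiv ℝ f y v) U :=
  (hf.fderiv_of_isOpen hU (by simp)).clm_apply contDiffOn_const

/-- The derivative in direction `v`, extended by zero outside of `U`. -/
def dirDeriv (v : E) : Derivation ℝ (smoothOn U) (smoothOn U) := by
  classical
  exact Derivation.mk'
    -- Ring elements are total functions, so the derivation laws must also hold off U, where
    -- `fderiv` is uncontrolled. Cutting off by zero makes them trivial there.
    { toFun := fun f => ⟨U.indicator fun y => fderiv ℝ f.1 y v,
        (f.2.fderiv_apply_const hU v).congr fun y hy => Set.indicator_of_mem hy _⟩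
      map_add' := fun f g => by
        ext y
        by_cases hy : y ∈ U
        · have hf := (f.2.contDiffAt (hU.mem_nhds hy)).differentiableAt (by simp)
          have hg := (g.2.contDiffAt (hU.mem_nhds hy)).differentiableAt (by simp)
          simp [hy, fderiv_add hf hg]
        · simp [hy]
      map_smul' := fun r f => by
        ext y
        by_cases hy : y ∈ U
        · have hf := (f.2.contDiffAt (hU.mem_nhds hy)).differentiableAt (by simp)
          simp [hy, fderiv_const_smul hf]
        · simp [hy] }
    fun f g => by
      ext y
      by_cases hy : y ∈ U
      · have hf := (f.2.contDiffAt (hU.mem_nhds hy)).differentiableAt (by simp)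
        have hg := (g.2.contDiffAt (hU.mem_nhds hy)).differentiableAt (by simp)
        simp [hy, fderiv_mul hf hg]
      · simp [hy]

theorem dirDeriv_apply (v : E) (f : smoothOn U) {y : E} (hy : y ∈ U) :
    (dirDeriv hU v f).1 y = fderiv ℝ f.1 y v :=
  Set.indicator_of_mem hy fun y => fderiv ℝ f.1 y v

theorem dirDeriv_apply_of_notMem (v : E) (f : smoothOn U) {y : E} (hy : y ∉ U) :
    (dirDeriv hU v f).1 y = 0 :=
  Set.indicator_of_notMem hy fun y => fderiv ℝ f.1 y v

include hU in
theorem fderiv_congr_on {f g : E → ℝ} (h : Set.EqOn f g U) {y : E} (hy : y ∈ U) :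
    fderiv ℝ f y = fderiv ℝ g y :=
  (h.eventuallyEq_of_mem (hU.mem_nhds hy)).fderiv_eq

/-- On U this is the symmetry of the second derivative; off U both sides vanish because of the
cut-off. -/
theorem dirDeriv_comm (v w : E) (f : smoothOn U) :
    dirDeriv hU v (dirDeriv hU w f) = dirDeriv hU w (dirDeriv hU v f) := by
  have key : ∀ (v w : E) {y : E}, y ∈ U →
      (dirDeriv hU v (dirDeriv hU w f)).1 y = fderiv ℝ (fderiv ℝ f.1) y v w := fun v w y hy => by
    rw [dirDeriv_apply hU v _ hy,
      fderiv_congr_on hU (fun z hz => dirDeriv_apply hU w f hz) hy]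
    have hd : DifferentiableAt ℝ (fderiv ℝ f.1) y :=
      ((f.2.fderiv_of_isOpen hU (m := ∞) (by simp)).contDiffAt
        (hU.mem_nhds hy)).differentiableAt (by simp)
    rw [fderiv_clm_apply hd (differentiableAt_const _)]
    simp
  ext y
  by_cases hy : y ∈ U
  · rw [key v w hy, key w v hy]
    exact ((f.2.contDiffAt (hU.mem_nhds hy)).isSymmSndFDerivAt
      (by simpa using WithTop.coe_le_coe.2 (le_top : (2 : ℕ∞) ≤ ⊤))).eq v w
  · rw [dirDeriv_apply_of_notMem hU v _ hy, dirDeriv_apply_of_notMem hU w _ hy]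

end SmoothFunctions

/-! ### Coordinate formulas as pointwise evaluations of the connection algebra -/

namespace RiemCoord

variable {E : Type*} [NormedAddCommGroup E] [NormedSpace ℝ E]
  {ι : Type*} [Fintype ι] [DecidableEq ι] (b : Basis ι ℝ E) {U : Set E} (hU : IsOpen U)

omit [Fintype ι] [DecidableEq ι] in
include hU in
theorem pderiv_congr_on {f g : E → ℝ} (h : Set.EqOn f g U) (i : ι) :
    Set.EqOn (pderiv b i f) (pderiv b i g) U := fun y hy => by
  rw [pderiv, pderiv, fderiv_congr_on hU h hy]

/-- `G` is a smooth symmetric nondegenerate matrix valued function on `U`. -/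
structure IsMetricOn (G : E → Matrix ι ι ℝ) (U : Set E) : Prop where
  smooth : ∀ i j, ContDiffOn ℝ ∞ (fun y => G y i j) U
  symm : ∀ y ∈ U, ∀ i j, G y i j = G y j i
  det_ne_zero : ∀ y ∈ U, (G y).det ≠ 0

variable {G : E → Matrix ι ι ℝ}

open Classical in
/-- The matrix `G` over the ring of functions that are smooth on `U`, extended by the identity. -/
def smoothMatrix (hG : IsMetricOn G U) : Matrix ι ι (smoothOn U) :=
  -- The identity off U keeps the determinant nonzero at every point, hence a unit of the ring, so
  -- that the matrix inverse is a true inverse.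
  Matrix.of fun i j => ⟨fun y => if y ∈ U then G y i j else (1 : Matrix ι ι ℝ) i j,
    (hG.smooth i j).congr fun _ hy => if_pos hy⟩

/-- Evaluation at a point. -/
def evalAt (y : E) : smoothOn U →+* ℝ := (Pi.evalRingHom _ y).comp (smoothOn U).val.toRingHom

theorem evalAt_apply (y : E) (f : smoothOn U) : evalAt y f = f.1 y := rfl

theorem map_smoothMatrix (hG : IsMetricOn G U) {y : E} (hy : y ∈ U) :
    (smoothMatrix hG).map (evalAt y) = G y := by
  ext i j
  simp [smoothMatrix, evalAt_apply, hy]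

theorem isUnit_det_smoothMatrix (hG : IsMetricOn G U) : IsUnit (smoothMatrix hG).det := by
  have h0 : ∀ y, (smoothMatrix hG).det.1 y ≠ 0 := fun y => by
    rw [← evalAt_apply, RingHom.map_det]
    by_cases hy : y ∈ U
    · rw [RingHom.mapMatrix_apply, map_smoothMatrix hG hy]
      exact hG.det_ne_zero y hy
    · have : (evalAt y).mapMatrix (smoothMatrix hG) = 1 := by
        ext i j
        simp [smoothMatrix, evalAt_apply, hy]
      simp [this]
  refine IsUnit.of_mul_eq_one ⟨fun y => ((smoothMatrix hG).det.1 y)⁻¹,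
    (smoothMatrix hG).det.2.inv fun y _ => h0 y⟩ ?_
  ext y
  exact mul_inv_cancel₀ (h0 y)

theorem map_smoothMatrix_inv (hG : IsMetricOn G U) {y : E} (hy : y ∈ U) :
    (smoothMatrix hG)⁻¹.map (evalAt y) = (G y)⁻¹ := by
  refine (Matrix.inv_eq_right_inv ?_).symm
  rw [← map_smoothMatrix hG hy]
  have := congrArg (evalAt y).mapMatrix (Matrix.mul_nonsing_inv _ (isUnit_det_smoothMatrix hG))
  rwa [map_mul, map_one] at this

/-- The Levi-Civita connection of `G` on `U`. -/
def connectionData (hG : IsMetricOn G U) : ConnectionData ι (smoothOn U) :=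
  ConnectionData.ofMetric (fun i => dirDeriv hU (b i)) (fun i j => dirDeriv_comm hU (b i) (b j))
    (smoothMatrix hG) (smoothMatrix hG)⁻¹
    (by
      ext i j y
      by_cases hy : y ∈ U
      · simpa [smoothMatrix, hy] using hG.symm y hy j i
      · simp [smoothMatrix, hy, Matrix.one_apply, eq_comm])
    (Matrix.mul_nonsing_inv _ (isUnit_det_smoothMatrix hG))

variable (hG : IsMetricOn G U)

theorem connectionData_P {y : E} (hy : y ∈ U) (i j : ι) :
    ((connectionData b hU hG).P i j).1 y = (G y)⁻¹ i j :=
  congrFun (congrFun (map_smoothMatrix_inv hG hy) i) j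

/-- A ring element and the coordinate expression it represents agree only on U. Openness of U makes
that enough for derivatives, and the `Set.EqOn` form allows iteration. -/
theorem connectionData_D (i : ι) {r : smoothOn U} {h : E → ℝ} (hr : Set.EqOn r.1 h U) :
    Set.EqOn ((connectionData b hU hG).D i r).1 (pderiv b i h) U := fun y hy => by
  rw [← pderiv_congr_on b hU hr i hy]
  exact dirDeriv_apply hU (b i) r hy

theorem connectionData_Γ {y : E} (hy : y ∈ U) (i k j : ι) :
    ((connectionData b hU hG).Γ i k j).1 y = christoffel b G k i j y := by
  have hM : ∀ i j, Set.EqOn (smoothMatrix hG i j).1 (fun z => G z i j) U := fun i j z hz =>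
    congrFun (congrFun (map_smoothMatrix hG hz) i) j
  have hD : ∀ i j k, (dirDeriv hU (b i) (smoothMatrix hG j k)).1 y
      = pderiv b i (fun z => G z j k) y := fun i j k =>
    connectionData_D b hU hG i (hM j k) hy
  have hP : ∀ i j, ((smoothMatrix hG)⁻¹ i j).1 y = (G y)⁻¹ i j :=
    connectionData_P b hU hG hy
  simp only [connectionData, ConnectionData.ofMetric, Matrix.of_apply, christoffel, ← hP, ← hD]
  rw [← evalAt_apply]
  simp [evalAt_apply]

theorem connectionData_riem {y : E} (hy : y ∈ U) (i j l k : ι) :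
    ((connectionData b hU hG).riem i j l k).1 y = curvature b G l k i j y := by
  have hΓ : ∀ i k j, Set.EqOn ((connectionData b hU hG).Γ i k j).1 (christoffel b G k i j) U :=
    fun i k j z hz => connectionData_Γ b hU hG hz i k j
  simp only [curvature]
  rw [← evalAt_apply]
  simp only [ConnectionData.riem, Matrix.add_apply, Matrix.sub_apply, Matrix.mul_apply,
    Matrix.map_apply, map_add, map_sub, map_sum, map_mul, Finset.sum_sub_distrib]
  simp only [evalAt_apply, connectionData_D b hU hG _ (hΓ _ _ _) hy, fun i k j => hΓ i k j hy]

/-- The covariant derivative `(∇_{∂_i} X)^α` of a vector field. -/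
def nablaVec (G : E → Matrix ι ι ℝ) (i : ι) (X : ι → E → ℝ) (α : ι) (y : E) : ℝ :=
  pderiv b i (X α) y + ∑ γ, christoffel b G α i γ y * X γ y

/-- The components of the gradient. -/
def gradVec (G : E → Matrix ι ι ℝ) (f : E → ℝ) (α : ι) (y : E) : ℝ :=
  ∑ k, (G y)⁻¹ α k * pderiv b k f y

/-- The squared norm of the gradient. -/
def gradSq (G : E → Matrix ι ι ℝ) (f : E → ℝ) (y : E) : ℝ :=
  ∑ i, ∑ j, (G y)⁻¹ i j * pderiv b i f y * pderiv b j f y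

theorem connectionData_nabla (i : ι) {X : ι → smoothOn U} {Y : ι → E → ℝ}
    (h : ∀ α, Set.EqOn (X α).1 (Y α) U) (α : ι) :
    Set.EqOn ((connectionData b hU hG).nabla i X α).1 (nablaVec b G i Y α) U := fun y hy => by
  rw [← evalAt_apply]
  simp only [ConnectionData.nabla, nablaVec, map_add, map_sum, map_mul]
  simp only [evalAt_apply, connectionData_D b hU hG _ (h _) hy, connectionData_Γ b hU hG hy,
    fun α => h α hy]

variable {f : E → ℝ} (hf : ContDiffOn ℝ ∞ f U)

theorem connectionData_grad (α : ι) :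
    Set.EqOn ((connectionData b hU hG).grad ⟨f, hf⟩ α).1 (gradVec b G f α) U := fun y hy => by
  rw [← evalAt_apply]
  simp only [ConnectionData.grad, gradVec, map_sum, map_mul]
  simp only [evalAt_apply, connectionData_P b hU hG hy,
    connectionData_D b hU hG _ (r := ⟨f, hf⟩) (Set.eqOn_refl _ _) hy]

theorem connectionData_lap :
    Set.EqOn ((connectionData b hU hG).lap ⟨f, hf⟩).1 (laplacian b G f) U := fun y hy => by
  have h1 : ∀ i, Set.EqOn ((connectionData b hU hG).D i ⟨f, hf⟩).1 (pderiv b i f) U := fun i =>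
    connectionData_D b hU hG i (r := ⟨f, hf⟩) (Set.eqOn_refl _ _)
  rw [← evalAt_apply]
  simp only [ConnectionData.lap, ConnectionData.conabla, ConnectionData.diff, laplacian, map_sum,
    map_sub, map_mul]
  simp only [evalAt_apply, connectionData_P b hU hG hy, connectionData_Γ b hU hG hy,
    connectionData_D b hU hG _ (h1 _) hy, fun i => h1 i hy]

theorem connectionData_gradSq :
    Set.EqOn (∑ i, ∑ j, (connectionData b hU hG).P i j * (connectionData b hU hG).D i ⟨f, hf⟩ *
      (connectionData b hU hG).D j ⟨f, hf⟩ : smoothOn U).1 (gradSq b G f) U := fun y hy => by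
  rw [← evalAt_apply]
  simp only [gradSq, map_sum, map_mul]
  simp only [evalAt_apply, connectionData_P b hU hG hy,
    connectionData_D b hU hG _ (r := ⟨f, hf⟩) (Set.eqOn_refl _ _) hy]

/-- The function `Δf + 2 a f + (n / 2) |grad f|²`. -/
def potential (G : E → Matrix ι ι ℝ) (a n : ℝ) (f : E → ℝ) (y : E) : ℝ :=
  laplacian b G f y + 2 * a * f y + n / 2 * gradSq b G f y

/-- The potential as an element of the ring of smooth functions on `U`. -/
def smoothPotential (a n : ℝ) : smoothOn U :=
  (connectionData b hU hG).lap ⟨f, hf⟩ + (2 * a) • (⟨f, hf⟩ : smoothOn U)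
    + (n / 2) • ∑ i, ∑ j, (connectionData b hU hG).P i j * (connectionData b hU hG).D i ⟨f, hf⟩ *
      (connectionData b hU hG).D j ⟨f, hf⟩

theorem smoothPotential_eqOn (a n : ℝ) :
    Set.EqOn (smoothPotential b hU hG hf a n).1 (potential b G a n f) U := fun y hy => by
  rw [potential, ← connectionData_lap b hU hG hf hy, ← connectionData_gradSq b hU hG hf hy]
  rfl

include hU hG hf in
theorem contDiffOn_potential (a n : ℝ) : ContDiffOn ℝ ∞ (potential b G a n f) U :=
  (smoothPotential b hU hG hf a n).2.congr fun _ hy => (smoothPotential_eqOn b hU hG hf a n hy).symm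

include hU hG in
-- `traceRiem_eq` turns the trace into minus the Ricci endomorphism, which is a times the identity.
-- The Einstein equation is needed only at the point y, since Ricci is never differentiated.
theorem sum_inv_mul_curvature {y : E} (hy : y ∈ U) {a : ℝ}
    (hric : ∀ j k, ricci b G j k y = a * G y j k) (α γ : ι) :
    ∑ i, ∑ j, (G y)⁻¹ i j * curvature b G α j i γ y = -a * (1 : Matrix ι ι ℝ) α γ := by
  have h := congrArg (evalAt y) ((connectionData b hU hG).traceRiem_eq α γ)
  simp only [ConnectionData.traceRiem, map_sum, map_neg, map_mul] at h
  simp only [evalAt_apply, connectionData_P b hU hG hy, connectionData_riem b hU hG hy] at h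
  rw [h]
  change -∑ k, (G y)⁻¹ α k * ricci b G γ k y = _
  have hm : ∑ k, (G y)⁻¹ α k * G y k γ = (1 : Matrix ι ι ℝ) α γ := by
    rw [← Matrix.nonsing_inv_mul (G y) (isUnit_iff_ne_zero.mpr (hG.det_ne_zero y hy)),
      Matrix.mul_apply]
  rw [neg_mul, ← hm, Finset.mul_sum]
  congr 1
  exact Finset.sum_congr rfl fun k _ => by rw [hric, hG.symm y hy γ k]; ring

include hU hG hf in
/-- The gradient of `Δf + 2 a f + (n / 2) |grad f|²` for an Einstein metric. -/
theorem gradVec_potential {y : E} (hy : y ∈ U) {a n : ℝ}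
    (hric : ∀ j k, ricci b G j k y = a * G y j k) (α : ι) :
    gradVec b G (potential b G a n f) α y =
      ∑ i, ∑ j, (G y)⁻¹ i j * (nablaVec b G i (nablaVec b G j (gradVec b G f)) α y
        - ∑ k, christoffel b G k i j y * nablaVec b G k (gradVec b G f) α y)
      + n * ∑ i, gradVec b G f i y * nablaVec b G i (gradVec b G f) α y
      - ∑ γ, (∑ i, ∑ j, (G y)⁻¹ i j * curvature b G α j i γ y) * gradVec b G f γ y := by
  set c := connectionData b hU hG
  set F : smoothOn U := ⟨f, hf⟩
  have hD : ∀ k, Set.EqOn (c.D k F).1 (pderiv b k f) U := fun k =>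
    connectionData_D b hU hG k (r := F) (Set.eqOn_refl _ _)
  have hgrad : ∀ α, Set.EqOn (c.grad F α).1 (gradVec b G f α) U := connectionData_grad b hU hG hf
  have hn1 : ∀ i α, Set.EqOn (c.nabla i (c.grad F) α).1 (nablaVec b G i (gradVec b G f) α) U :=
    fun i => connectionData_nabla b hU hG i hgrad
  have hn2 : ∀ i j α, Set.EqOn (c.nabla i (c.nabla j (c.grad F)) α).1
      (nablaVec b G i (nablaVec b G j (gradVec b G f)) α) U :=
    fun i j => connectionData_nabla b hU hG i (hn1 j)
  have hP : ∀ i j, (c.P i j).1 y = (G y)⁻¹ i j := connectionData_P b hU hG hy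
  have hΓ : ∀ i k j, (c.Γ i k j).1 y = christoffel b G k i j y := connectionData_Γ b hU hG hy
  have h1 := c.rough_laplacian_grad F α
  have h2 := c.two_mul_nabla_grad_grad F α
  have h3 : ∑ k, c.P α k * c.D k (smoothPotential b hU hG hf a n)
      = ∑ k, c.P α k * c.D k (c.lap F) + (2 * a) • c.grad F α
        + (n / 2) • ∑ k, c.P α k * c.D k (∑ i, ∑ j, c.P i j * c.D i F * c.D j F) := by
    simp only [smoothPotential, map_add, Derivation.map_smul, mul_add, Finset.sum_add_distrib,
      mul_smul_comm, ← Finset.smul_sum, ConnectionData.grad, c, F]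
  rw [← h2] at h3
  have hpot : ∀ k, (c.D k (smoothPotential b hU hG hf a n)).1 y
      = pderiv b k (potential b G a n f) y := fun k =>
    connectionData_D b hU hG k (smoothPotential_eqOn b hU hG hf a n) hy
  have htr : ∀ s k, (c.traceRiem s k).1 y = -a * (1 : Matrix ι ι ℝ) s k := fun s k => by
    rw [← sum_inv_mul_curvature b hU hG hy hric s k, ← evalAt_apply]
    simp only [ConnectionData.traceRiem, map_sum, map_mul]
    simp only [evalAt_apply, hP, c, connectionData_riem b hU hG hy]
  have e1 := congrArg (evalAt y) h1
  simp only [map_sum, map_mul, map_sub] at e1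
  simp only [evalAt_apply, htr, hP, hΓ, hn1 _ _ hy, hn2 _ _ _ hy, hD _ hy] at e1
  have e3 : evalAt y (∑ k, c.P α k * c.D k (smoothPotential b hU hG hf a n))
      = evalAt y (∑ k, c.P α k * c.D k (c.lap F)) + (2 * a) * evalAt y (c.grad F α)
        + (n / 2) * evalAt y (2 * ∑ i, c.grad F i * c.nabla i (c.grad F) α) :=
    congrArg (evalAt y) h3
  simp only [map_sum, map_mul, map_ofNat] at e3
  simp only [evalAt_apply, hP, hn1 _ _ hy, hgrad _ hy, hpot] at e3
  -- One a grad f comes from this curvature term and another from Bochner's formula in `e1`;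
  -- together they account for the 2a in the potential.
  have e4 : ∑ γ, (∑ i, ∑ j, (G y)⁻¹ i j * curvature b G α j i γ y) * gradVec b G f γ y
      = -a * gradVec b G f α y := by
    simp [sum_inv_mul_curvature b hU hG hy hric, Matrix.one_apply]
  have e5 : ∀ k, ∑ s, -a * (1 : Matrix ι ι ℝ) s k * pderiv b s f y = -a * pderiv b k f y :=
    fun k => by simp [Matrix.one_apply]
  have e6 : ∑ k, (G y)⁻¹ α k * (-a * pderiv b k f y) = -a * gradVec b G f α y := by
    rw [gradVec, Finset.mul_sum]
    exact Finset.sum_congr rfl fun _ _ => by ring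
  simp only [e5, mul_sub, Finset.sum_sub_distrib] at e1
  simp only [mul_sub, Finset.sum_sub_distrib]
  rw [e4, gradVec, e3]
  rw [e6] at e1
  linear_combination -e1

end RiemCoord

/-! ### The projection of a warped product in product coordinates -/

namespace RiemCoord

section Product

variable {E F : Type*} [NormedAddCommGroup E] [NormedSpace ℝ E] [NormedAddCommGroup F]
  [NormedSpace ℝ F] {ι κ : Type*} (b : Basis ι ℝ E) (c : Basis κ ℝ F)

theorem differentiableAt_comp_fst_iff {h : E → ℝ} {z : E × F} :
    DifferentiableAt ℝ (fun w : E × F => h w.1) z ↔ DifferentiableAt ℝ h z.1 := by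
  refine ⟨fun hd => ?_, fun hd => hd.comp z differentiableAt_fst⟩
  have : DifferentiableAt ℝ (fun x : E => (x, z.2)) z.1 := by fun_prop
  exact DifferentiableAt.comp z.1 (g := fun w : E × F => h w.1) hd this

/-- No differentiability is required: h and its pull-back are differentiable simultaneously, and
otherwise both derivatives take the default value zero. -/
theorem fderiv_comp_fst (h : E → ℝ) (z v : E × F) :
    fderiv ℝ (fun w : E × F => h w.1) z v = fderiv ℝ h z.1 v.1 := by
  by_cases hd : DifferentiableAt ℝ h z.1
  · have := (hd.hasFDerivAt.comp z hasFDerivAt_fst).fderiv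
    exact congrArg (fun L : E × F →L[ℝ] ℝ => L v) this
  · rw [fderiv_zero_of_not_differentiableAt hd,
      fderiv_zero_of_not_differentiableAt (mt differentiableAt_comp_fst_iff.mp hd)]
    rfl

theorem pderiv_inl_comp_fst (h : E → ℝ) (i : ι) (z : E × F) :
    pderiv (b.prod c) (Sum.inl i) (fun w => h w.1) z = pderiv b i h z.1 := by
  simp [pderiv, fderiv_comp_fst]

theorem pderiv_inr_comp_fst (h : E → ℝ) (i : κ) (z : E × F) :
    pderiv (b.prod c) (Sum.inr i) (fun w => h w.1) z = 0 := by
  simp [pderiv, fderiv_comp_fst]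

theorem pderiv_inl_mul_comp_snd {h : E → ℝ} {k : F → ℝ} {z : E × F}
    (hh : DifferentiableAt ℝ h z.1) (hk : DifferentiableAt ℝ k z.2) (i : ι) :
    pderiv (b.prod c) (Sum.inl i) (fun w => h w.1 * k w.2) z = pderiv b i h z.1 * k z.2 := by
  have := ((hh.hasFDerivAt.comp z hasFDerivAt_fst).mul
    (hk.hasFDerivAt.comp z hasFDerivAt_snd)).fderiv
  have := congrArg (fun L : E × F →L[ℝ] ℝ => L (b.prod c (Sum.inl i))) this
  refine this.trans ?_
  simp [pderiv, mul_comm]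

theorem pderiv_exp {h : E → ℝ} {y : E} (hh : DifferentiableAt ℝ h y) (i : ι) :
    pderiv b i (fun x => Real.exp (2 * h x)) y = 2 * Real.exp (2 * h y) * pderiv b i h y := by
  have := ((hh.hasFDerivAt.const_mul 2).exp).fderiv
  have := congrArg (fun L : E →L[ℝ] ℝ => L (b i)) this
  simp only [pderiv, this]
  simp
  ring

theorem pderiv_const (i : ι) (r : ℝ) (y : E) : pderiv b i (fun _ => r) y = 0 := by
  simp [pderiv]

theorem pderiv_const_mul (i : ι) (r : ℝ) (h : E → ℝ) (y : E) :
    pderiv b i (fun x => r * h x) y = r * pderiv b i h y := by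
  have : (fun x => r * h x) = r • h := rfl
  rw [pderiv, this, fderiv_const_smul_field]
  rfl

theorem pderiv_comp_id [Fintype ι] [DecidableEq ι] (i α : ι) (y : E) :
    pderiv b i (comp b id α) y = if i = α then 1 else 0 := by
  have : FiniteDimensional ℝ E := b.finiteDimensional_of_finite
  have h : comp b id α = LinearMap.toContinuousLinearMap (b.coord α) := rfl
  rw [pderiv, h, ContinuousLinearMap.fderiv]
  simp [Finsupp.single_apply]

end Product

variable {E : Type*} [NormedAddCommGroup E] [NormedSpace ℝ E] {ι : Type*} [Fintype ι]
  [DecidableEq ι] (b : Basis ι ℝ E) (G : E → Matrix ι ι ℝ)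

theorem nablaVec_const_mul (r : ℝ) (i : ι) (X : ι → E → ℝ) (α : ι) (y : E) :
    nablaVec b G i (fun β y => r * X β y) α y = r * nablaVec b G i X α y := by
  simp only [nablaVec, pderiv_const_mul, mul_add, Finset.mul_sum]
  congr 1
  exact Finset.sum_congr rfl fun _ _ => by ring

theorem christoffel_symm {U : Set E} (hU : IsOpen U) (hG : IsMetricOn G U) {y : E} (hy : y ∈ U)
    (k i j : ι) : christoffel b G k i j y = christoffel b G k j i y := by
  rw [← connectionData_Γ b hU hG hy, ← connectionData_Γ b hU hG hy, ConnectionData.torsion]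

variable {F : Type*} [NormedAddCommGroup F] [NormedSpace ℝ F]
  {κ : Type*} [Fintype κ] [DecidableEq κ] (c : Basis κ ℝ F) (K : F → Matrix κ κ ℝ)
  (f : E → ℝ)

/-- The matrix of the warped product metric. -/
def warpedMatrix (z : E × F) : Matrix (ι ⊕ κ) (ι ⊕ κ) ℝ :=
  Matrix.fromBlocks (G z.1) 0 0 (Real.exp (2 * f z.1) • K z.2)

variable {G K f} {U : Set E} {V : Set F} (hU : IsOpen U) (hV : IsOpen V)
  (hG : IsMetricOn G U) (hK : IsMetricOn K V) (hf : ContDiffOn ℝ ∞ f U)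
  {W : E × F → Matrix (ι ⊕ κ) (ι ⊕ κ) ℝ} (hW : Set.EqOn W (warpedMatrix G K f) (U ×ˢ V))
  {u : E × F → E} (hu : Set.EqOn u Prod.fst (U ×ˢ V)) {z : E × F} (hz : z ∈ U ×ˢ V)

include hG hK hz hW in
theorem inv_warped : (W z)⁻¹ =
    Matrix.fromBlocks (G z.1)⁻¹ 0 0 (Real.exp (-(2 * f z.1)) • (K z.2)⁻¹) := by
  refine Matrix.inv_eq_right_inv ?_
  rw [hW hz, warpedMatrix, Matrix.fromBlocks_multiply]
  simp [Matrix.mul_nonsing_inv _ (isUnit_iff_ne_zero.mpr (hG.det_ne_zero _ hz.1)),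
    Matrix.mul_nonsing_inv _ (isUnit_iff_ne_zero.mpr (hK.det_ne_zero _ hz.2)), smul_smul,
    ← Real.exp_add]

include hU hV hG hK hz hW in
theorem christoffel_warped_inl (k i j : ι) :
    christoffel (b.prod c) W (Sum.inl k) (Sum.inl i) (Sum.inl j) z
      = christoffel b G k i j z.1 := by
  have h : ∀ i j : ι, Set.EqOn (fun w => W w (Sum.inl i) (Sum.inl j)) (fun w => G w.1 i j)
      (U ×ˢ V) := fun i j w hw => by simp [hW hw, warpedMatrix]
  simp only [christoffel, inv_warped hG hK hW hz, Fintype.sum_sum_type,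
    Matrix.fromBlocks_apply₁₁, Matrix.fromBlocks_apply₁₂, Matrix.zero_apply, zero_mul,
    Finset.sum_const_zero, add_zero, pderiv_congr_on (b.prod c) (hU.prod hV) (h _ _) _ hz]
  have h' : ∀ i j l, pderiv (b.prod c) (Sum.inl l) (fun w : E × F => G w.1 i j) z
      = pderiv b l (fun y => G y i j) z.1 := fun i j l =>
    pderiv_inl_comp_fst b c (fun y => G y i j) l z
  simp only [h']

include hU hV hG hK hf hz hW in
-- The mixed blocks vanish, so only -½ G^{kl} ∂_l (e^{2f} K_{ij}) survives. This is the second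
-- fundamental form of the fibres, and it is how grad f enters the tension field.
theorem christoffel_warped_inr (k : ι) (i j : κ) :
    christoffel (b.prod c) W (Sum.inl k) (Sum.inr i) (Sum.inr j) z
      = -(Real.exp (2 * f z.1) * K z.2 i j) * gradVec b G f k z.1 := by
  have h1 : ∀ i j, Set.EqOn (fun w => W w (Sum.inr i) (Sum.inl j)) (fun _ => 0) (U ×ˢ V) :=
    fun i j w hw => by simp [hW hw, warpedMatrix]
  have h2 : ∀ i j, Set.EqOn (fun w => W w (Sum.inr i) (Sum.inr j))
      (fun w => Real.exp (2 * f w.1) * K w.2 i j) (U ×ˢ V) :=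
    fun i j w hw => by simp [hW hw, warpedMatrix]
  have hdf : DifferentiableAt ℝ f z.1 :=
    (hf.contDiffAt (hU.mem_nhds hz.1)).differentiableAt (by simp)
  have hdK : DifferentiableAt ℝ (fun y => K y i j) z.2 :=
    ((hK.smooth i j).contDiffAt (hV.mem_nhds hz.2)).differentiableAt (by simp)
  simp only [christoffel, inv_warped hG hK hW hz, Fintype.sum_sum_type,
    Matrix.fromBlocks_apply₁₁, Matrix.fromBlocks_apply₁₂, Matrix.zero_apply, zero_mul,
    Finset.sum_const_zero, add_zero, pderiv_congr_on (b.prod c) (hU.prod hV) (h1 _ _) _ hz,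
    pderiv_congr_on (b.prod c) (hU.prod hV) (h2 _ _) _ hz, pderiv_const]
  simp only [pderiv_inl_mul_comp_snd b c (h := fun x => Real.exp (2 * f x))
    (k := fun y => K y i j) (by fun_prop) hdK, pderiv_exp b hdf, gradVec, Finset.mul_sum]
  exact Finset.sum_congr rfl fun _ _ => by ring

omit [Fintype ι] [DecidableEq ι] [NormedAddCommGroup F] [NormedSpace ℝ F] in
include hu in
theorem comp_eqOn (α : ι) :
    Set.EqOn (comp b u α) (fun w : E × F => comp b id α w.1) (U ×ˢ V) := fun w hw => by
  simp [comp, hu hw]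

omit [Fintype κ] [DecidableEq κ] in
include hU hV hu in
theorem pderiv_inl_comp (i α : ι) :
    Set.EqOn (pderiv (b.prod c) (Sum.inl i) (comp b u α)) (fun _ => if i = α then 1 else 0)
      (U ×ˢ V) := fun w hw => by
  rw [pderiv_congr_on (b.prod c) (hU.prod hV) (comp_eqOn b hu α) _ hw,
    pderiv_inl_comp_fst b c (comp b id α), pderiv_comp_id]

omit [Fintype ι] [DecidableEq ι] [Fintype κ] [DecidableEq κ] in
include hU hV hu in
theorem pderiv_inr_comp (i : κ) (α : ι) :
    Set.EqOn (pderiv (b.prod c) (Sum.inr i) (comp b u α)) (fun _ => 0) (U ×ˢ V) := fun w hw => by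
  rw [pderiv_congr_on (b.prod c) (hU.prod hV) (comp_eqOn b hu α) _ hw,
    pderiv_inr_comp_fst b c (comp b id α)]

variable (G) {X : ι → E × F → ℝ} {Y : ι → E → ℝ}
  (hXY : ∀ α, Set.EqOn (X α) (fun w => Y α w.1) (U ×ˢ V))

omit [Fintype κ] [DecidableEq κ] in
include hU hV hu hXY in
-- A field pulled back from the base has a covariant derivative that is again pulled back from the
-- base, so the lemma can be applied to its own output to obtain second derivatives.
theorem nablaAlong_inl (i α : ι) :
    Set.EqOn (nablaAlong (b.prod c) b G u (Sum.inl i) X α) (fun w => nablaVec b G i Y α w.1)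
      (U ×ˢ V) := fun w hw => by
  simp only [nablaAlong, nablaVec, pderiv_inl_comp b c hU hV hu i _ hw,
    pderiv_congr_on (b.prod c) (hU.prod hV) (hXY α) _ hw, pderiv_inl_comp_fst b c (Y α),
    hXY _ hw, hu hw]
  rw [Finset.sum_comm]
  simp

omit [Fintype κ] [DecidableEq κ] in
include hU hV hu hXY in
theorem nablaAlong_inr (i : κ) (α : ι) :
    Set.EqOn (nablaAlong (b.prod c) b G u (Sum.inr i) X α) (fun _ => 0) (U ×ˢ V) := fun w hw => by
  simp only [nablaAlong, pderiv_inr_comp b c hU hV hu i _ hw,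
    pderiv_congr_on (b.prod c) (hU.prod hV) (hXY α) _ hw, pderiv_inr_comp_fst b c (Y α)]
  simp

variable {G}

omit [NormedAddCommGroup E] [NormedSpace ℝ E] in
include hK hz in
-- The trace of K with respect to itself is the fibre dimension; every factor n arises here.
theorem sum_inv_mul_self (r : ℝ) :
    ∑ i, ∑ j, (K z.2)⁻¹ i j * (K z.2 i j * r) = Fintype.card κ * r := by
  have h : ∀ i, ∑ j, (K z.2)⁻¹ i j * (K z.2 i j * r) = r := fun i => by
    have := congrFun (congrFun (Matrix.nonsing_inv_mul (K z.2)
      (isUnit_iff_ne_zero.mpr (hK.det_ne_zero _ hz.2))) i) i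
    rw [Matrix.mul_apply, Matrix.one_apply_eq] at this
    calc _ = (∑ j, (K z.2)⁻¹ i j * K z.2 j i) * r := by
          rw [Finset.sum_mul]
          exact Finset.sum_congr rfl fun j _ => by rw [hK.symm _ hz.2 i j]; ring
      _ = r := by rw [this, one_mul]
  simp [h]

include hU hV hG hK hf hW hu in
/-- The tension field of the projection is `n grad f`. -/
theorem tension_warped (α : ι) :
    Set.EqOn (tension (b.prod c) b W G u α) (fun w => Fintype.card κ * gradVec b G f α w.1)
      (U ×ˢ V) := fun z hz => by
  have h1 := fun i j => nablaAlong_inl b G c hU hV hu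
    (Y := fun β _ => if j = β then 1 else 0) (pderiv_inl_comp b c hU hV hu j) i α hz
  have h2 := fun i j => nablaAlong_inr b G c hU hV hu
    (Y := fun β _ => 0) (pderiv_inr_comp b c hU hV hu j) i α hz
  -- The covariant derivative of a coordinate field is a Christoffel symbol, which cancels the
  -- subtracted one. The base block therefore contributes nothing to the tension.
  have h3 : ∀ i j, nablaVec b G i (fun β _ => if j = β then 1 else 0) α z.1
      = christoffel b G α i j z.1 := fun i j => by
    simp [nablaVec, pderiv_const]
  simp only [tension, inv_warped hG hK hW hz, Fintype.sum_sum_type,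
    Matrix.fromBlocks_apply₁₁, Matrix.fromBlocks_apply₁₂, Matrix.fromBlocks_apply₂₁,
    Matrix.fromBlocks_apply₂₂, Matrix.zero_apply, zero_mul, Finset.sum_const_zero, add_zero,
    zero_add, h1, h2, h3, pderiv_inl_comp b c hU hV hu _ _ hz,
    pderiv_inr_comp b c hU hV hu _ _ hz, christoffel_warped_inl b c hU hV hG hK hW hz,
    christoffel_warped_inr b c hU hV hG hK hf hW hz]
  rw [← sum_inv_mul_self hK hz]
  simp [Real.exp_neg]
  refine Finset.sum_congr rfl fun i _ => Finset.sum_congr rfl fun j _ => ?_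
  field_simp

include hU hV hG hK hf hW hu hz in
-- The base block yields the rough Laplacian of n grad f and the curvature term. The fibre block
-- contributes only its Christoffel term. The sum is n times the right-hand side of
-- `gradVec_potential`.
theorem bitension_warped {a : ℝ} (hric : ∀ j k, ricci b G j k z.1 = a * G z.1 j k) (α : ι) :
    bitension (b.prod c) b W G u α z
      = Fintype.card κ * gradVec b G (potential b G a (Fintype.card κ) f) α z.1 := by
  have ht := tension_warped b c hU hV hG hK hf hW hu
  have h1 : ∀ i β, Set.EqOn _ _ _ := fun i β =>
    nablaAlong_inl b G c hU hV hu (Y := fun β y => Fintype.card κ * gradVec b G f β y) ht i β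
  have h2 := fun i β => nablaAlong_inr b G c hU hV hu
    (Y := fun β y => Fintype.card κ * gradVec b G f β y) ht i β
  have h3 := fun i j => nablaAlong_inl b G c hU hV hu (h1 j) i α hz
  have h4 := fun i (j : κ) => nablaAlong_inr b G c hU hV hu (Y := fun _ _ => 0) (h2 j) i α hz
  have h5 : ∀ j, nablaVec b G j (fun β y => Fintype.card κ * gradVec b G f β y)
      = fun β y => Fintype.card κ * nablaVec b G j (gradVec b G f) β y := fun j => by
    ext β y
    exact nablaVec_const_mul b G _ j _ β y
  rw [gradVec_potential b hU hG hf hz.1 hric]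
  simp only [bitension, traceNablaSq, inv_warped hG hK hW hz, Fintype.sum_sum_type,
    Matrix.fromBlocks_apply₁₁, Matrix.fromBlocks_apply₁₂, Matrix.fromBlocks_apply₂₁,
    Matrix.fromBlocks_apply₂₂, Matrix.zero_apply, zero_mul, Finset.sum_const_zero, add_zero,
    zero_add, h1 _ _ hz, h2 _ _ hz, h3, h4, h5, nablaVec_const_mul,
    pderiv_inl_comp b c hU hV hu _ _ hz,
    pderiv_inr_comp b c hU hV hu _ _ hz, christoffel_warped_inl b c hU hV hG hK hW hz,
    christoffel_warped_inr b c hU hV hG hK hf hW hz, ht _ hz, hu hz, mul_zero]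
  -- The factors e^{-2f} and e^{2f} cancel. The fibre trace produces one factor n, in addition to
  -- the n already carried by the tension field.
  have e1 : ∑ i, ∑ j, (Real.exp (-(2 * f z.1)) • (K z.2)⁻¹) i j * (0 - ∑ k,
      -(Real.exp (2 * f z.1) * K z.2 i j) * gradVec b G f k z.1 *
        (Fintype.card κ * nablaVec b G k (gradVec b G f) α z.1))
      = Fintype.card κ * (Fintype.card κ *
        ∑ k, gradVec b G f k z.1 * nablaVec b G k (gradVec b G f) α z.1) := by
    rw [← sum_inv_mul_self hK hz]
    refine Finset.sum_congr rfl fun i _ => Finset.sum_congr rfl fun j _ => ?_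
    rw [zero_sub, ← Finset.sum_neg_distrib]
    simp only [Matrix.smul_apply, smul_eq_mul, Finset.mul_sum, Real.exp_neg]
    refine Finset.sum_congr rfl fun k _ => ?_
    field_simp
  rw [e1]
  have e2 : ∀ i j, ∑ β, ∑ γ, ∑ δ, curvature b G α δ β γ z.1 * (if i = β then 1 else 0) *
      (Fintype.card κ * gradVec b G f γ z.1) * (if j = δ then 1 else 0)
      = Fintype.card κ * ∑ γ, curvature b G α j i γ z.1 * gradVec b G f γ z.1 := fun i j => by
    rw [Finset.sum_comm]
    simp [Finset.mul_sum]
    refine Finset.sum_congr rfl fun k _ => by ring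
  simp only [e2]
  have e3 : ∑ γ, (∑ i, ∑ j, (G z.1)⁻¹ i j * curvature b G α j i γ z.1) * gradVec b G f γ z.1
      = ∑ i, ∑ j, (G z.1)⁻¹ i j * ∑ γ, curvature b G α j i γ z.1 * gradVec b G f γ z.1 := by
    simp only [Finset.sum_mul, Finset.mul_sum]
    rw [Finset.sum_comm]
    refine Finset.sum_congr rfl fun i _ => ?_
    rw [Finset.sum_comm]
    exact Finset.sum_congr rfl fun _ _ => Finset.sum_congr rfl fun _ _ => by ring
  rw [e3]
  simp only [Finset.mul_sum, mul_sub, mul_add, Finset.sum_sub_distrib, mul_left_comm _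
    (Fintype.card κ : ℝ)]

end RiemCoord

/-! ### Change of coordinates for Christoffel symbols, gradient norm and Laplacian -/

/-- The trace of a bilinear form with respect to a metric does not depend on the basis. -/
theorem Matrix.sum_inv_mul_transform {ι : Type*} [Fintype ι] [DecidableEq ι]
    {G J : Matrix ι ι ℝ} (T : Matrix ι ι ℝ) (hG : (J.transpose * G * J).det ≠ 0) :
    ∑ i, ∑ j, (J.transpose * G * J)⁻¹ i j * (J.transpose * T * J) i j
      = ∑ i, ∑ j, G⁻¹ i j * T i j := by
  have hJ : IsUnit J.det := isUnit_iff_ne_zero.mpr fun h => hG (by simp [h])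
  have hJt : IsUnit J.transpose.det := by rwa [Matrix.det_transpose]
  have key : ∀ A B : Matrix ι ι ℝ, ∑ i, ∑ j, A i j * B i j = (A * B.transpose).trace :=
    fun A B => rfl
  rw [key, key, Matrix.mul_inv_rev, Matrix.mul_inv_rev, Matrix.transpose_mul, Matrix.transpose_mul,
    Matrix.transpose_transpose]
  calc _ = (J⁻¹ * (G⁻¹ * ((J.transpose⁻¹ * J.transpose) * T.transpose) * J)).trace := by
        simp only [Matrix.mul_assoc]
    _ = _ := by
      rw [Matrix.nonsing_inv_mul _ hJt, one_mul, Matrix.trace_mul_comm, Matrix.mul_assoc,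
        Matrix.mul_nonsing_inv _ hJ, mul_one]

namespace RiemCoord

variable {E : Type*} [NormedAddCommGroup E] [NormedSpace ℝ E]
  {ι : Type*} [Fintype ι] [DecidableEq ι] (b : Basis ι ℝ E)

/-- The compatibility of the Christoffel symbols with the metric. -/
theorem pderiv_metric {G : E → Matrix ι ι ℝ} {U : Set E} (hU : IsOpen U) (hG : IsMetricOn G U)
    {y : E} (hy : y ∈ U) (i : ι) :
    (Matrix.of fun j k => pderiv b i (fun z => G z j k) y)
      = (Matrix.of fun k j => christoffel b G k i j y).transpose * G y
        + G y * Matrix.of fun k j => christoffel b G k i j y := by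
  have hM : ∀ i j, Set.EqOn (smoothMatrix hG i j).1 (fun z => G z i j) U := fun i j z hz =>
    congrFun (congrFun (map_smoothMatrix hG hz) i) j
  have h := (connectionData b hU hG).compat i
  ext j k
  have h := congrArg (evalAt y) (congrFun (congrFun h j) k)
  simp only [Matrix.map_apply, Matrix.add_apply, Matrix.mul_apply, Matrix.transpose_apply,
    map_add, map_sum, map_mul] at h
  simp only [evalAt_apply, connectionData_Γ b hU hG hy] at h
  have hD : ((connectionData b hU hG).D i ((connectionData b hU hG).G j k)).1 y
      = pderiv b i (fun z => G z j k) y := connectionData_D b hU hG i (hM j k) hy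
  have hG' : ∀ j k, ((connectionData b hU hG).G j k).1 y = G y j k := fun j k => hM j k hy
  rw [hD] at h
  simp only [hG'] at h
  simpa [Matrix.mul_apply] using h

/-- Uniqueness of the Levi-Civita connection. -/
theorem christoffel_unique {G : E → Matrix ι ι ℝ} {y : E} (hs : ∀ i j, G y i j = G y j i)
    (hdet : (G y).det ≠ 0) (Γ : ι → Matrix ι ι ℝ) (hΓ : ∀ i j k, Γ i k j = Γ j k i)
    (hc : ∀ i, (Matrix.of fun j k => pderiv b i (fun z => G z j k) y)
      = (Γ i).transpose * G y + G y * Γ i) (k i j : ι) :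
    christoffel b G k i j y = Γ i k j := by
  have h : ∀ i j k, pderiv b i (fun z => G z j k) y
      = ∑ s, G y k s * Γ i s j + ∑ s, G y j s * Γ i s k := fun i j k => by
    simpa [Matrix.mul_apply, mul_comm, hs k] using congrFun (congrFun (hc i) j) k
  have hS : ∀ l i j, ∑ s, G y l s * Γ i s j = ∑ s, G y l s * Γ j s i := fun l i j => by
    simp only [hΓ i j]
  -- The Koszul combination: compatibility is used three times, and torsion-freeness cancels all
  -- terms but two equal ones.
  have h1 : ∀ l, pderiv b i (fun z => G z j l) y + pderiv b j (fun z => G z i l) y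
      - pderiv b l (fun z => G z i j) y = 2 * ∑ s, G y l s * Γ i s j := fun l => by
    rw [h, h, h]
    linear_combination hS l j i + hS j i l + hS i j l
  have h2 : ((G y)⁻¹ * (G y * Γ i)) k j = Γ i k j := by
    rw [← Matrix.mul_assoc, Matrix.nonsing_inv_mul _ (isUnit_iff_ne_zero.mpr hdet), one_mul]
  simp only [Matrix.mul_apply] at h2
  rw [christoffel, ← h2, Finset.mul_sum]
  exact Finset.sum_congr rfl fun l _ => by rw [h1]; ring

section ChangeOfCoordinates

variable {G G' : E → Matrix ι ι ℝ} {U U' : Set E} (hU : IsOpen U) (hU' : IsOpen U')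
  (hG : IsMetricOn G U) (hG' : IsMetricOn G' U') {ψ : E → E} (hψ : ContDiffOn ℝ ∞ ψ U')
  (hmaps : Set.MapsTo ψ U' U)

/-- The Jacobian matrix of a map. -/
def jacobian (ψ : E → E) (y : E) : Matrix ι ι ℝ := Matrix.of fun a i => pderiv b i (comp b ψ a) y

variable [FiniteDimensional ℝ E]

omit [Fintype ι] [DecidableEq ι] in
include hψ in
theorem contDiffOn_comp (a : ι) : ContDiffOn ℝ ∞ (comp b ψ a) U' :=
  (LinearMap.toContinuousLinearMap (b.coord a)).contDiff.comp_contDiffOn hψ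

/-- The Jacobian matrix over the ring of smooth functions. -/
def smoothJacobian : Matrix ι ι (smoothOn U') :=
  Matrix.of fun a i => dirDeriv hU' (b i) ⟨comp b ψ a, contDiffOn_comp b hψ a⟩

omit [Fintype ι] [DecidableEq ι] in
theorem map_smoothJacobian {y : E} (hy : y ∈ U') :
    (smoothJacobian b hU' hψ).map (evalAt y) = jacobian b ψ y := by
  ext a i
  exact dirDeriv_apply hU' (b i) _ hy

omit [DecidableEq ι] in
include hU hψ hU' hmaps in
theorem pderiv_comp {h : E → ℝ} (hh : ContDiffOn ℝ ∞ h U) {y : E} (hy : y ∈ U') (i : ι) :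
    pderiv b i (fun z => h (ψ z)) y = ∑ a, pderiv b a h (ψ y) * jacobian b ψ y a i := by
  have hdh : DifferentiableAt ℝ h (ψ y) :=
    (hh.contDiffAt (hU.mem_nhds (hmaps hy))).differentiableAt (by simp)
  have hdψ : DifferentiableAt ℝ ψ y :=
    (hψ.contDiffAt (hU'.mem_nhds hy)).differentiableAt (by simp)
  have h1 : ∀ a, jacobian b ψ y a i = b.repr (fderiv ℝ ψ y (b i)) a := fun a => by
    have := ((LinearMap.toContinuousLinearMap (b.coord a)).hasFDerivAt.comp y
      hdψ.hasFDerivAt).fderiv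
    exact congrArg (fun L : E →L[ℝ] ℝ => L (b i)) this
  have h2 := congrArg (fun L : E →L[ℝ] ℝ => L (b i)) (hdh.hasFDerivAt.comp y hdψ.hasFDerivAt).fderiv
  refine h2.trans ?_
  change fderiv ℝ h (ψ y) (fderiv ℝ ψ y (b i)) = _
  conv_lhs => rw [← b.sum_repr (fderiv ℝ ψ y (b i))]
  simp only [map_sum, map_smul, smul_eq_mul, h1, pderiv]
  exact Finset.sum_congr rfl fun _ _ => mul_comm _ _

variable (htrans : ∀ y ∈ U', G' y = (jacobian b ψ y).transpose * G (ψ y) * jacobian b ψ y)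

/-- The second derivatives of `ψ`. -/
def hessMatrix (i : ι) (y : E) : Matrix ι ι ℝ :=
  ((smoothJacobian b hU' hψ).map (dirDeriv hU' (b i))).map (evalAt y)

include hU hG hG' hmaps htrans in
/-- The transformation law of the Christoffel symbols. -/
theorem jacobian_mul_christoffel {y : E} (hy : y ∈ U') (i : ι) :
    jacobian b ψ y * (Matrix.of fun k j => christoffel b G' k i j y)
      = (∑ a, jacobian b ψ y a i • Matrix.of fun k j => christoffel b G k a j (ψ y))
        * jacobian b ψ y + hessMatrix b hU' hψ i y := by
  set J := jacobian b ψ y with hJdef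
  set B : ι → Matrix ι ι ℝ := fun i =>
    ∑ a, J a i • Matrix.of fun k j => christoffel b G k a j (ψ y) with hB
  set dJ := fun i => hessMatrix b hU' hψ i y with hdJ
  have hdet : (J.transpose * G (ψ y) * J).det ≠ 0 := htrans y hy ▸ hG'.det_ne_zero y hy
  have hJ : IsUnit J.det := isUnit_iff_ne_zero.mpr fun h => hdet (by simp [h])
  have hJt : IsUnit J.transpose.det := by rwa [Matrix.det_transpose]
  -- The candidate for the connection of G' has matrices J⁻¹ (B i J + dJ i). It is torsion free by
  -- the symmetry shown here, and compatible with G' = Jᵀ G J by Leibniz, so `christoffel_unique`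
  -- identifies it.
  have hsymm : ∀ i j k, (B i * J + dJ i) k j = (B j * J + dJ j) k i := fun i j k => by
    have e1 : dJ i k j = dJ j k i := congrArg (evalAt y) (dirDeriv_comm hU' (b i) (b j) _)
    have e2 : ∀ i j, (B i * J) k j
        = ∑ a, ∑ s, christoffel b G k a s (ψ y) * J a i * J s j := fun i j => by
      simp only [hB, Matrix.mul_apply, Matrix.sum_apply, Matrix.smul_apply, Matrix.of_apply,
        smul_eq_mul, Finset.sum_mul]
      rw [Finset.sum_comm]
      exact Finset.sum_congr rfl fun _ _ => Finset.sum_congr rfl fun _ _ => by ring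
    rw [Matrix.add_apply, Matrix.add_apply, e1, e2, e2, Finset.sum_comm]
    congr 1
    refine Finset.sum_congr rfl fun a _ => Finset.sum_congr rfl fun s _ => ?_
    rw [christoffel_symm b G hU hG (hmaps hy)]
    ring
  have hcompat : ∀ i, (Matrix.of fun j k => pderiv b i (fun z => G' z j k) y)
      = (J⁻¹ * (B i * J + dJ i)).transpose * G' y + G' y * (J⁻¹ * (B i * J + dJ i)) := fun i => by
    let Gm : Matrix ι ι (smoothOn U') :=
      Matrix.of fun j k => ⟨fun z => G (ψ z) j k, (hG.smooth j k).comp hψ hmaps⟩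
    let Jm := smoothJacobian b hU' hψ
    have hJm : Jm.map (evalAt y) = J := map_smoothJacobian b hU' hψ hy
    have hGm : Gm.map (evalAt y) = G (ψ y) := rfl
    have e1 : (Matrix.of fun j k => pderiv b i (fun z => G' z j k) y)
        = ((Jm.transpose * Gm * Jm).map (dirDeriv hU' (b i))).map (evalAt y) := by
      ext j k
      refine Eq.trans ?_ (dirDeriv_apply hU' (b i) ((Jm.transpose * Gm * Jm) j k) hy).symm
      refine pderiv_congr_on b hU' (fun z hz => ?_) i hy
      have : G' z = (evalAt z).mapMatrix (Jm.transpose * Gm * Jm) := by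
        rw [map_mul, map_mul, RingHom.mapMatrix_apply, RingHom.mapMatrix_apply,
          RingHom.mapMatrix_apply, Matrix.transpose_map, map_smoothJacobian b hU' hψ hz,
          htrans z hz]
        rfl
      exact congrFun (congrFun this j) k
    have e2 : (Gm.map (dirDeriv hU' (b i))).map (evalAt y)
        = (B i).transpose * G (ψ y) + G (ψ y) * B i := by
      have h1 : (Gm.map (dirDeriv hU' (b i))).map (evalAt y)
          = ∑ a, J a i • (Matrix.of fun j k => pderiv b a (fun z => G z j k) (ψ y)) := by
        ext j k
        refine (dirDeriv_apply hU' (b i) (Gm j k) hy).trans ?_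
        refine (pderiv_comp b hU hU' hψ hmaps (hG.smooth j k) hy i).trans ?_
        simp only [Matrix.sum_apply, Matrix.smul_apply, Matrix.of_apply, smul_eq_mul]
        exact Finset.sum_congr rfl fun _ _ => mul_comm _ _
      rw [h1]
      simp only [pderiv_metric b hU hG (hmaps hy), hB, Matrix.transpose_sum, Matrix.sum_mul,
        Matrix.mul_sum, smul_add, Finset.sum_add_distrib, Matrix.transpose_smul, Matrix.smul_mul,
        Matrix.mul_smul]
    have e3 : ((Jm.transpose * Gm * Jm).map (dirDeriv hU' (b i))).map (evalAt y)
        = (dJ i).transpose * G (ψ y) * J + J.transpose *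
          ((B i).transpose * G (ψ y) + G (ψ y) * B i) * J + J.transpose * G (ψ y) * dJ i := by
      rw [← e2, ← hGm, ← hJm]
      simp only [Matrix.map_derivation_mul, ← RingHom.mapMatrix_apply, map_add, map_mul]
      simp only [RingHom.mapMatrix_apply, Matrix.transpose_map, hdJ, hessMatrix, add_mul]
      rfl
    rw [e1, e3, htrans y hy, ← hJdef, Matrix.transpose_mul]
    have c1 : (J⁻¹).transpose * J.transpose = 1 := by
      rw [← Matrix.transpose_mul, Matrix.mul_nonsing_inv _ hJ, Matrix.transpose_one]
    have c2 : J * J⁻¹ = 1 := Matrix.mul_nonsing_inv _ hJ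
    have r1 : (B i * J + dJ i).transpose * (J⁻¹).transpose * (J.transpose * G (ψ y) * J)
        = (B i * J + dJ i).transpose * G (ψ y) * J := by
      calc _ = (B i * J + dJ i).transpose * ((J⁻¹).transpose * J.transpose) * G (ψ y) * J := by
            simp only [Matrix.mul_assoc]
        _ = _ := by rw [c1, mul_one]
    have r2 : J.transpose * G (ψ y) * J * (J⁻¹ * (B i * J + dJ i))
        = J.transpose * G (ψ y) * (B i * J + dJ i) := by
      calc _ = J.transpose * G (ψ y) * (J * J⁻¹) * (B i * J + dJ i) := by
            simp only [Matrix.mul_assoc]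
        _ = _ := by rw [c2, mul_one]
    rw [r1, r2, Matrix.transpose_add, Matrix.transpose_mul]
    noncomm_ring
  have huniq := christoffel_unique b (hG'.symm y hy) (hG'.det_ne_zero y hy)
    (fun i => J⁻¹ * (B i * J + dJ i)) (fun i j k => by
      simp only [Matrix.mul_apply (M := J⁻¹), hsymm i j]) hcompat
  have : (Matrix.of fun k j => christoffel b G' k i j y) = J⁻¹ * (B i * J + dJ i) := by
    ext k j
    exact huniq k i j
  rw [this, ← Matrix.mul_assoc, Matrix.mul_nonsing_inv _ hJ, one_mul]

variable {f : E → ℝ} (hf : ContDiffOn ℝ ∞ f U)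

include hU hU' hG' hψ hmaps htrans hf in
theorem gradSq_comp {y : E} (hy : y ∈ U') :
    gradSq b G' (fun z => f (ψ z)) y = gradSq b G f (ψ y) := by
  have hdet := htrans y hy ▸ hG'.det_ne_zero y hy
  have h := Matrix.sum_inv_mul_transform
    (Matrix.of fun i j => pderiv b i f (ψ y) * pderiv b j f (ψ y)) hdet
  rw [← htrans y hy] at h
  simp only [gradSq, mul_assoc]
  refine Eq.trans ?_ h
  refine Finset.sum_congr rfl fun i _ => Finset.sum_congr rfl fun j _ => ?_
  congr 1
  rw [pderiv_comp b hU hU' hψ hmaps hf hy, pderiv_comp b hU hU' hψ hmaps hf hy]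
  simp only [Matrix.mul_apply, Matrix.of_apply, Matrix.transpose_apply, Finset.sum_mul,
    Finset.mul_sum]
  exact Finset.sum_congr rfl fun _ _ => Finset.sum_congr rfl fun _ _ => by ring

include hU hU' hG hG' hψ hmaps htrans hf in
-- By the chain rule and by the Christoffel transformation law, the same second-derivative term of ψ
-- appears in both halves of the Hessian and cancels. The Hessian thus transforms by Jᵀ · J, and its
-- trace is invariant.
theorem laplacian_comp {y : E} (hy : y ∈ U') :
    laplacian b G' (fun z => f (ψ z)) y = laplacian b G f (ψ y) := by
  have hdet := htrans y hy ▸ hG'.det_ne_zero y hy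
  have h := Matrix.sum_inv_mul_transform
    (Matrix.of fun i j => pderiv b i (pderiv b j f) (ψ y)
      - ∑ k, christoffel b G k i j (ψ y) * pderiv b k f (ψ y)) hdet
  rw [← htrans y hy] at h
  refine Eq.trans ?_ h
  refine Finset.sum_congr rfl fun i _ => Finset.sum_congr rfl fun j _ => ?_
  congr 1
  have hd : ∀ a, ContDiffOn ℝ ∞ (pderiv b a f) U := fun a => hf.fderiv_apply_const hU _
  have e1 : pderiv b i (pderiv b j fun z => f (ψ z)) y
      = ∑ a, (∑ c, pderiv b c (pderiv b a f) (ψ y) * jacobian b ψ y c i) * jacobian b ψ y a j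
        + ∑ a, pderiv b a f (ψ y) * hessMatrix b hU' hψ i y a j := by
    let df : ι → smoothOn U' := fun a => ⟨fun z => pderiv b a f (ψ z), (hd a).comp hψ hmaps⟩
    have h1 : Set.EqOn (pderiv b j fun z => f (ψ z))
        (∑ a, df a * smoothJacobian b hU' hψ a j : smoothOn U').1 U' := fun z hz => by
      rw [pderiv_comp b hU hU' hψ hmaps hf hz, ← evalAt_apply, ← map_smoothJacobian b hU' hψ hz]
      simp only [map_sum, map_mul, Matrix.map_apply]
      rfl
    rw [pderiv_congr_on b hU' h1 i hy]
    refine (dirDeriv_apply hU' (b i) _ hy).symm.trans ?_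
    rw [← evalAt_apply, ← map_smoothJacobian b hU' hψ hy]
    simp only [map_sum, Derivation.leibniz, map_add, map_mul, smul_eq_mul, Finset.sum_add_distrib]
    rw [add_comm]
    congr 1
    refine Finset.sum_congr rfl fun a _ => ?_
    rw [mul_comm, Matrix.map_apply, map_smoothJacobian b hU' hψ hy]
    congr 1
    exact (dirDeriv_apply hU' (b i) (df a) hy).trans (pderiv_comp b hU hU' hψ hmaps (hd a) hy i)
  have e2 : ∑ k, christoffel b G' k i j y * pderiv b k (fun z => f (ψ z)) y
      = ∑ a, pderiv b a f (ψ y) * (∑ c, ∑ s, christoffel b G a c s (ψ y) * jacobian b ψ y c i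
          * jacobian b ψ y s j + hessMatrix b hU' hψ i y a j) := by
    have h1 : ∀ a, ∑ k, jacobian b ψ y a k * christoffel b G' k i j y
        = ∑ c, ∑ s, christoffel b G a c s (ψ y) * jacobian b ψ y c i
          * jacobian b ψ y s j + hessMatrix b hU' hψ i y a j := fun a => by
      have := congrFun (congrFun
        (jacobian_mul_christoffel b hU hU' hG hG' hψ hmaps htrans hy i) a) j
      simp only [Matrix.add_apply, Matrix.mul_apply, Matrix.of_apply, Matrix.sum_apply,
        Matrix.smul_apply, smul_eq_mul, Finset.sum_mul] at this
      rw [this]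
      congr 1
      exact Finset.sum_congr rfl fun _ _ => Finset.sum_congr rfl fun _ _ => by ring
    simp only [← h1, pderiv_comp b hU hU' hψ hmaps hf hy, Finset.mul_sum]
    rw [Finset.sum_comm]
    exact Finset.sum_congr rfl fun _ _ => Finset.sum_congr rfl fun _ _ => by ring
  rw [e1, e2]
  simp only [mul_add, Finset.sum_add_distrib, add_sub_add_right_eq_sub, Matrix.mul_apply,
    Matrix.of_apply, Matrix.transpose_apply, Finset.sum_mul, Finset.mul_sum, mul_sub, sub_mul,
    Finset.sum_sub_distrib]
  congr 1
  · exact Finset.sum_congr rfl fun _ _ => Finset.sum_congr rfl fun _ _ => by ring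
  · rw [Finset.sum_comm]
    conv_rhs => rw [Finset.sum_comm]
    refine Finset.sum_congr rfl fun _ _ => ?_
    rw [Finset.sum_comm]
    exact Finset.sum_congr rfl fun _ _ => Finset.sum_congr rfl fun _ _ => by ring

end ChangeOfCoordinates

end RiemCoord

/-! ### The metric in the charts of a manifold, and transition maps -/

section Charts

variable {E : Type*} [NormedAddCommGroup E] [NormedSpace ℝ E]
  {H : Type*} [TopologicalSpace H] {I : ModelWithCorners ℝ E H} [I.Boundaryless]
  {M : Type*} [TopologicalSpace M] [ChartedSpace H M] [IsManifold I ∞ M]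
  {ι : Type*} (b : Basis ι ℝ E) (g : RiemannianMetricOn I M)

/-- The differential of the inverse of the chart at `p`, as a map between model spaces. -/
def chartSymmDeriv (I : ModelWithCorners ℝ E H) {M : Type*} [TopologicalSpace M]
    [ChartedSpace H M] (p : M) (y : E) : E →L[ℝ] E :=
  mfderiv 𝓘(ℝ, E) I (extChartAt I p).symm y

/-- The metric at a point, as a bilinear form on the model space. -/
def modelForm (x : M) : E →L[ℝ] E →L[ℝ] ℝ := g.inner x

omit [I.Boundaryless] in
-- Replacing all tangent spaces by the model space E removes the dependence of types on the base
-- point, so that points can be rewritten freely.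
theorem metricCoord_apply (p : M) (y : E) (i j : ι) :
    metricCoord b g p y i j = modelForm g ((extChartAt I p).symm y)
      (chartSymmDeriv I p y (b i)) (chartSymmDeriv I p y (b j)) := rfl

omit [I.Boundaryless] in
include I in
theorem isManifold_one : IsManifold I 1 M :=
  IsManifold.of_le (n := ∞) (WithTop.coe_le_coe.2 le_top)

theorem isInvertible_chartSymmDeriv {p : M} {y : E} (hy : y ∈ (extChartAt I p).target) :
    (chartSymmDeriv I p y).IsInvertible := by
  have := isManifold_one (I := I) (M := M)
  have h := isInvertible_mfderivWithin_extChartAt_symm (I := I) hy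
  rwa [I.range_eq_univ, mfderivWithin_univ] at h

theorem chartSymmDeriv_self (p : M) :
    chartSymmDeriv I p (extChartAt I p p) = ContinuousLinearMap.id ℝ E := by
  have := isManifold_one (I := I) (M := M)
  have h := mfderivWithin_range_extChartAt_symm (I := I) (x := p)
  rwa [I.range_eq_univ, mfderivWithin_univ] at h

/-- The coordinate fields of the chart at p are the constant sections of the tangent bundle
trivialization at p, hence smooth. -/
theorem contMDiffAt_coordVec {p : M} {y : E} (hy : y ∈ (extChartAt I p).target) (v : E) :
    ContMDiffAt 𝓘(ℝ, E) I.tangent ∞ (fun z => (⟨(extChartAt I p).symm z,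
      mfderiv 𝓘(ℝ, E) I (extChartAt I p).symm z v⟩ : TangentBundle I M)) y := by
  have := isManifold_one (I := I) (M := M)
  let t := trivializationAt E (TangentSpace I : M → Type _) p
  have hbase : ∀ z ∈ (extChartAt I p).target, (extChartAt I p).symm z ∈ t.baseSet := fun z hz => by
    have := (extChartAt I p).map_target hz
    rw [extChartAt_source] at this
    simpa [t] using this
  have hs : ContMDiffAt (I.prod 𝓘(ℝ, E)) I.tangent ∞ t.toOpenPartialHomeomorph.symm
      ((extChartAt I p).symm y, v) :=
    (t.contMDiffOn_symm (IB := I) (n := ∞)).contMDiffAt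
      (t.open_target.mem_nhds (by simpa [t.mem_target] using hbase y hy))
  have hopen := isOpen_extChartAt_target (I := I) p
  have hc : ContMDiffAt 𝓘(ℝ, E) (I.prod 𝓘(ℝ, E)) ∞ (fun z => ((extChartAt I p).symm z, v)) y :=
    ((contMDiffOn_extChartAt_symm p).contMDiffAt (hopen.mem_nhds hy)).prodMk contMDiffAt_const
  refine (ContMDiffAt.comp y hs hc).congr_of_eventuallyEq ?_
  filter_upwards [hopen.mem_nhds hy] with z hz
  refine Eq.trans ?_ (t.mk_symm (hbase z hz) v)
  have hsrc := (extChartAt I p).map_target hz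
  rw [extChartAt_source] at hsrc
  have h := TangentBundle.symmL_trivializationAt (I := I) hsrc
  rw [(extChartAt I p).right_inv hz, I.range_eq_univ, mfderivWithin_univ] at h
  have h' : t.symm ((extChartAt I p).symm z) v
      = mfderiv 𝓘(ℝ, E) I (extChartAt I p).symm z v :=
    (t.symmL_apply (R := ℝ) (hbase z hz) v).symm.trans (congrArg (fun L : E →L[ℝ] E => L v) h)
  rw [h']

theorem contDiffOn_metricCoord (p : M) (i j : ι) :
    ContDiffOn ℝ ∞ (fun y => metricCoord b g p y i j) (extChartAt I p).target := by
  intro y hy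
  refine (contMDiffAt_iff_contDiffAt.mp ?_).contDiffWithinAt
  have hopen := isOpen_extChartAt_target (I := I) p
  have : ContMDiffAt 𝓘(ℝ, E) (I.prod 𝓘(ℝ)) ∞
      (fun z => TotalSpace.mk' ℝ (E := Bundle.Trivial M ℝ) ((extChartAt I p).symm z)
        (g.inner ((extChartAt I p).symm z) (coordVec (I := I) b p z i)
          (coordVec (I := I) b p z j))) y := by
    apply ContMDiffAt.clm_bundle_apply₂ (F₁ := E) (F₂ := E)
    · exact ContMDiffAt.comp y g.contMDiff.contMDiffAt
        ((contMDiffOn_extChartAt_symm p).contMDiffAt (hopen.mem_nhds hy))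
    · exact contMDiffAt_coordVec hy (b i)
    · exact contMDiffAt_coordVec hy (b j)
  exact (contMDiffAt_totalSpace.1 this).2

open RiemCoord

variable [Fintype ι] [DecidableEq ι]

theorem isMetricOn_metricCoord (p : M) :
    IsMetricOn (metricCoord b g p) (extChartAt I p).target where
  smooth := contDiffOn_metricCoord b g p
  symm y _ i j := g.symm _ _ _
  -- A kernel vector of the Gram matrix would give a tangent vector of length zero, and the chart
  -- differential is injective.
  det_ne_zero y hy hdet := by
    obtain ⟨v, hv, h0⟩ := Matrix.exists_mulVec_eq_zero_iff.mpr hdet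
    let w : E := ∑ i, v i • b i
    have hw : modelForm g ((extChartAt I p).symm y) (chartSymmDeriv I p y w)
        (chartSymmDeriv I p y w) = 0 := by
      have : modelForm g ((extChartAt I p).symm y) (chartSymmDeriv I p y w)
        (chartSymmDeriv I p y w) = ∑ i, v i * (metricCoord b g p y).mulVec v i := by
        simp only [w, map_sum, map_smul, sum_apply,
          smul_apply, smul_eq_mul, Matrix.mulVec, dotProduct, metricCoord_apply,
          Finset.mul_sum]
        rw [Finset.sum_comm]
        exact Finset.sum_congr rfl fun _ _ => Finset.sum_congr rfl fun _ _ => by ring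
      rw [this, h0]
      simp
    have hw0 : chartSymmDeriv I p y w = 0 := by
      by_contra hne
      exact (g.pos _ (chartSymmDeriv I p y w) hne).ne' hw
    have hw1 : w = 0 := by
      obtain ⟨e, he⟩ := isInvertible_chartSymmDeriv hy
      rw [← he] at hw0
      simpa using hw0
    exact hv (funext fun i => Fintype.linearIndependent_iff.mp b.linearIndependent v hw1 i)

/-- The overlap of the charts at `p` and `q`, in the coordinates of the chart at `p`. -/
def chartOverlap (I : ModelWithCorners ℝ E H) {M : Type*} [TopologicalSpace M]
    [ChartedSpace H M] (p q : M) : Set E :=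
  (extChartAt I p).target ∩ (extChartAt I p).symm ⁻¹' (extChartAt I q).source

/-- The transition map from the chart at `p` to the chart at `q`. -/
def transition (I : ModelWithCorners ℝ E H) {M : Type*} [TopologicalSpace M]
    [ChartedSpace H M] (p q : M) (y : E) : E :=
  extChartAt I q ((extChartAt I p).symm y)

variable (p q : M)

omit [IsManifold I ∞ M] in
theorem isOpen_chartOverlap : IsOpen (chartOverlap I p q) :=
  (continuousOn_extChartAt_symm p).isOpen_inter_preimage (isOpen_extChartAt_target p)
    (isOpen_extChartAt_source q)

omit [I.Boundaryless] in
theorem contDiffOn_transition : ContDiffOn ℝ ∞ (transition I p q) (chartOverlap I p q) :=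
  contMDiffOn_iff_contDiffOn.mp <| (contMDiffOn_extChartAt (x := q) (I := I) (n := ∞)).comp
    ((contMDiffOn_extChartAt_symm p).mono Set.inter_subset_left)
    fun y hy => by simpa using hy.2

omit [I.Boundaryless] [IsManifold I ∞ M] in
theorem mapsTo_transition :
    Set.MapsTo (transition I p q) (chartOverlap I p q) (extChartAt I q).target :=
  fun _ hy => (extChartAt I q).map_source hy.2

omit [I.Boundaryless] [IsManifold I ∞ M] in
theorem symm_transition {y : E} (hy : y ∈ chartOverlap I p q) :
    (extChartAt I q).symm (transition I p q y) = (extChartAt I p).symm y :=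
  (extChartAt I q).left_inv hy.2

theorem chartSymmDeriv_transition {y : E} (hy : y ∈ chartOverlap I p q) (v : E) :
    chartSymmDeriv I p y v
      = chartSymmDeriv I q (transition I p q y) (fderiv ℝ (transition I p q) y v) := by
  have h1 : MDifferentiableAt 𝓘(ℝ, E) 𝓘(ℝ, E) (transition I p q) y :=
    (((contDiffOn_transition p q).contDiffAt
      ((isOpen_chartOverlap p q).mem_nhds hy)).differentiableAt (by simp)).mdifferentiableAt
  have h2 : MDifferentiableAt 𝓘(ℝ, E) I (extChartAt I q).symm (transition I p q y) :=
    ((contMDiffOn_extChartAt_symm (n := ∞) q).contMDiffAt ((isOpen_extChartAt_target q).mem_nhds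
      (mapsTo_transition p q hy))).mdifferentiableAt (by simp)
  have h3 : (extChartAt I p).symm =ᶠ[nhds y] (extChartAt I q).symm ∘ transition I p q := by
    filter_upwards [(isOpen_chartOverlap p q).mem_nhds hy] with z hz
    exact (symm_transition p q hz).symm
  have h4 := h3.mfderiv_eq (I := 𝓘(ℝ, E)) (I' := I)
  rw [mfderiv_comp y h2 h1, mfderiv_eq_fderiv] at h4
  exact congrArg (fun L : E →L[ℝ] E => L v) h4

omit [DecidableEq ι] in
theorem metricCoord_transition {y : E} (hy : y ∈ chartOverlap I p q) :
    metricCoord b g p y = (jacobian b (transition I p q) y).transpose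
      * metricCoord b g q (transition I p q y) * jacobian b (transition I p q) y := by
  have := b.finiteDimensional_of_finite
  have hd : DifferentiableAt ℝ (transition I p q) y :=
    ((contDiffOn_transition p q).contDiffAt
      ((isOpen_chartOverlap p q).mem_nhds hy)).differentiableAt (by simp)
  have hJ : ∀ i, fderiv ℝ (transition I p q) y (b i)
      = ∑ a, jacobian b (transition I p q) y a i • b a := fun i => by
    conv_lhs => rw [← b.sum_repr (fderiv ℝ (transition I p q) y (b i))]
    refine Finset.sum_congr rfl fun a _ => ?_
    congr 1
    have := ((LinearMap.toContinuousLinearMap (b.coord a)).hasFDerivAt.comp y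
      hd.hasFDerivAt).fderiv
    exact (congrArg (fun L : E →L[ℝ] ℝ => L (b i)) this).symm
  ext i j
  simp only [Matrix.mul_apply, Matrix.transpose_apply, metricCoord_apply, Finset.sum_mul]
  rw [chartSymmDeriv_transition p q hy, chartSymmDeriv_transition p q hy, hJ, hJ,
    symm_transition p q hy]
  simp only [map_sum, map_smul, sum_apply, smul_apply,
    smul_eq_mul, Finset.mul_sum]
  exact Finset.sum_congr rfl fun _ _ => Finset.sum_congr rfl fun _ _ => by ring

end Charts

/-! ### The potential as a function on the manifold, and constancy on connected manifolds -/

namespace RiemCoord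

variable {E : Type*} [NormedAddCommGroup E] [NormedSpace ℝ E]
  {ι : Type*} [Fintype ι] [DecidableEq ι] (b : Basis ι ℝ E)

theorem laplacian_congr_on {U : Set E} (hU : IsOpen U) (G : E → Matrix ι ι ℝ) {f f' : E → ℝ}
    (h : Set.EqOn f f' U) : Set.EqOn (laplacian b G f) (laplacian b G f') U := fun y hy => by
  simp only [laplacian, pderiv_congr_on b hU h _ hy,
    pderiv_congr_on b hU (pderiv_congr_on b hU h _) _ hy]

theorem gradSq_congr_on {U : Set E} (hU : IsOpen U) (G : E → Matrix ι ι ℝ) {f f' : E → ℝ}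
    (h : Set.EqOn f f' U) : Set.EqOn (gradSq b G f) (gradSq b G f') U := fun y hy => by
  simp only [gradSq, pderiv_congr_on b hU h _ hy]

theorem IsMetricOn.mono {G : E → Matrix ι ι ℝ} {U V : Set E} (h : IsMetricOn G V) (hUV : U ⊆ V) :
    IsMetricOn G U where
  smooth i j := (h.smooth i j).mono hUV
  symm y hy := h.symm y (hUV hy)
  det_ne_zero y hy := h.det_ne_zero y (hUV hy)

theorem gradVec_eq_zero_iff {G : E → Matrix ι ι ℝ} {y : E} (hG : (G y).det ≠ 0) (f : E → ℝ) :
    (∀ α, gradVec b G f α y = 0) ↔ fderiv ℝ f y = 0 := by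
  constructor
  · intro h
    have h0 : (G y)⁻¹.mulVec (fun k => pderiv b k f y) = 0 := funext h
    have h1 : (fun k => pderiv b k f y) = 0 := by
      have := congrArg (G y).mulVec h0
      rwa [Matrix.mulVec_mulVec, Matrix.mul_nonsing_inv _ (isUnit_iff_ne_zero.mpr hG),
        Matrix.one_mulVec, Matrix.mulVec_zero] at this
    exact ContinuousLinearMap.coe_injective (b.ext fun i => congrFun h1 i)
  · intro h α
    simp [gradVec, pderiv, h]

end RiemCoord

open RiemCoord

section Charts

variable {E : Type*} [NormedAddCommGroup E] [NormedSpace ℝ E]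
  {H : Type*} [TopologicalSpace H] {I : ModelWithCorners ℝ E H} [I.Boundaryless]
  {M : Type*} [TopologicalSpace M] [ChartedSpace H M] [IsManifold I ∞ M]
  {ι : Type*} [Fintype ι] [DecidableEq ι] (b : Basis ι ℝ E) (g : RiemannianMetricOn I M)
  {f : M → ℝ} (hf : ContMDiff I 𝓘(ℝ, ℝ) ∞ f)

omit [I.Boundaryless] in
include hf in
theorem contDiffOn_comp_chart_symm (p : M) :
    ContDiffOn ℝ ∞ (f ∘ (extChartAt I p).symm) (extChartAt I p).target :=
  contMDiffOn_iff_contDiffOn.mp (hf.comp_contMDiffOn (contMDiffOn_extChartAt_symm p))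

omit [IsManifold I ∞ M] in
include hf in
theorem differential_apply (p : M) (v : E) :
    differential (I := I) f p v = fderiv ℝ (f ∘ (extChartAt I p).symm) (extChartAt I p p) v := by
  have h := ((hf p).mdifferentiableAt (by simp)).mfderiv
  rw [I.range_eq_univ, fderivWithin_univ] at h
  exact congrArg (fun L : E →L[ℝ] ℝ => L v) h

include hf in
-- At its own centre the chart has identity differential, so the Gram matrix of the basis is the
-- coordinate matrix; multiplying by its inverse then collapses one of the two gradients.
theorem gradientNormSq_eq (p : M) :
    gradientNormSq b g f p
      = gradSq b (metricCoord b g p) (f ∘ (extChartAt I p).symm) (extChartAt I p p) := by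
  set y := extChartAt I p p
  set P := (metricCoord b g p y)⁻¹
  set w : ι → ℝ := fun i => pderiv b i (f ∘ (extChartAt I p).symm) y
  have hG : ∀ i j, modelForm g p (b i) (b j) = metricCoord b g p y i j := fun i j => by
    rw [metricCoord_apply, chartSymmDeriv_self, extChartAt_to_inv]
    rfl
  have hP : (Matrix.of fun k l =>
      g.inner p (basisVec (I := I) b p k) (basisVec (I := I) b p l))⁻¹ = P := by
    congr 1
    ext i j
    exact hG i j
  have hgrad : (riemGradient b g f p : E) = ∑ i, (∑ j, P i j * w j) • b i := by
    simp only [Finset.sum_smul]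
    rw [riemGradient, hP]
    refine Finset.sum_congr rfl fun i _ => Finset.sum_congr rfl fun j _ => ?_
    rw [show differential (I := I) f p (basisVec (I := I) b p j) = w j from
      differential_apply hf p (b j)]
    rfl
  have hdet : IsUnit (metricCoord b g p y).det := isUnit_iff_ne_zero.mpr
    ((isMetricOn_metricCoord b g p).det_ne_zero y (mem_extChartAt_target p))
  have hmul : ∀ i, ∑ j, metricCoord b g p y i j * ∑ k, P j k * w k = w i := fun i => by
    have := congrFun (Matrix.mulVec_mulVec w (metricCoord b g p y) P) i
    rw [Matrix.mul_nonsing_inv _ hdet, Matrix.one_mulVec] at this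
    exact this
  calc gradientNormSq b g f p
      = modelForm g p (riemGradient b g f p : E) (riemGradient b g f p : E) := rfl
    _ = ∑ i, (∑ j, P i j * w j) * ∑ j, metricCoord b g p y i j * ∑ k, P j k * w k := by
      rw [hgrad]
      simp only [map_sum, map_smul, sum_apply, smul_apply, smul_eq_mul, hG]
      refine Finset.sum_congr rfl fun i _ => congrArg _ (Finset.sum_congr rfl fun j _ => ?_)
      rw [mul_comm, (isMetricOn_metricCoord b g p).symm y (mem_extChartAt_target p) j i]
    _ = _ := by
      simp only [hmul, gradSq, Finset.sum_mul]
      exact Finset.sum_congr rfl fun _ _ => Finset.sum_congr rfl fun _ _ => by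
        simp only [P, w]; ring

/-- The function `Δf + 2 a f + (n / 2) |grad f|²` on a manifold. -/
def manifoldPotential (a n : ℝ) (f : M → ℝ) (x : M) : ℝ :=
  laplaceBeltrami b g f x + 2 * a * f x + n / 2 * gradientNormSq b g f x

include hf in
-- On the left the chart changes with the point, so the derivative cannot be read off directly. The
-- invariance of Δ and |grad|² moves everything to the fixed chart at p.
theorem manifoldPotential_eqOn (a n : ℝ) (p : M) :
    Set.EqOn (manifoldPotential b g a n f ∘ (extChartAt I p).symm)
      (potential b (metricCoord b g p) a n (f ∘ (extChartAt I p).symm))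
      (extChartAt I p).target := by
  intro y hy
  have := b.finiteDimensional_of_finite
  set q := (extChartAt I p).symm y
  have hyo : y ∈ chartOverlap I p q := ⟨hy, mem_extChartAt_source q⟩
  have hψ : transition I p q y = extChartAt I q q := rfl
  have heq : Set.EqOn (fun z => (f ∘ (extChartAt I q).symm) (transition I p q z))
      (f ∘ (extChartAt I p).symm) (chartOverlap I p q) := fun z hz =>
    congrArg f (symm_transition p q hz)
  have h1 := laplacian_comp b (isOpen_extChartAt_target q) (isOpen_chartOverlap p q)
    (isMetricOn_metricCoord b g q)
    ((isMetricOn_metricCoord b g p).mono Set.inter_subset_left) (contDiffOn_transition p q)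
    (mapsTo_transition p q) (fun z hz => metricCoord_transition b g p q hz)
    (contDiffOn_comp_chart_symm hf q) hyo
  have h2 := gradSq_comp b (isOpen_extChartAt_target q) (isOpen_chartOverlap p q)
    ((isMetricOn_metricCoord b g p).mono Set.inter_subset_left) (contDiffOn_transition p q)
    (mapsTo_transition p q) (fun z hz => metricCoord_transition b g p q hz)
    (contDiffOn_comp_chart_symm hf q) hyo
  rw [laplacian_congr_on b (isOpen_chartOverlap p q) _ heq hyo, hψ] at h1
  rw [gradSq_congr_on b (isOpen_chartOverlap p q) _ heq hyo, hψ] at h2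
  change manifoldPotential b g a n f q = _
  rw [manifoldPotential, potential, h1, h2, gradientNormSq_eq b g hf, laplaceBeltrami]
  rfl

/-- A function whose differential vanishes in all charts is constant on a connected manifold. -/
theorem exists_const_iff_fderiv_eq_zero [ConnectedSpace M] {F : M → ℝ}
    (hF : ∀ p, ContDiffOn ℝ ∞ (F ∘ (extChartAt I p).symm) (extChartAt I p).target) :
    (∃ C, ∀ x, F x = C) ↔
      ∀ p, fderiv ℝ (F ∘ (extChartAt I p).symm) (extChartAt I p p) = 0 := by
  constructor
  · rintro ⟨C, hC⟩ p
    rw [show F ∘ (extChartAt I p).symm = fun _ => C from funext fun _ => hC _]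
    simp
  intro h
  -- The hypothesis concerns only the centre of each chart. A point y is the centre of the chart at
  -- its own image q, and the chain rule transfers the vanishing back to the chart at p.
  have hzero : ∀ p, ∀ y ∈ (extChartAt I p).target,
      fderiv ℝ (F ∘ (extChartAt I p).symm) y = 0 := fun p y hy => by
    set q := (extChartAt I p).symm y
    have hyo : y ∈ chartOverlap I p q := ⟨hy, mem_extChartAt_source q⟩
    have heq : Set.EqOn (F ∘ (extChartAt I p).symm)
        ((F ∘ (extChartAt I q).symm) ∘ transition I p q) (chartOverlap I p q) := fun z hz =>
      congrArg F (symm_transition p q hz).symm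
    rw [fderiv_congr_on (isOpen_chartOverlap p q) heq hyo, fderiv_comp]
    · rw [show transition I p q y = extChartAt I q q from rfl, h q, ContinuousLinearMap.zero_comp]
    · exact ((hF q).contDiffAt ((isOpen_extChartAt_target q).mem_nhds
        (mem_extChartAt_target q))).differentiableAt (by simp)
    · exact ((contDiffOn_transition p q).contDiffAt
        ((isOpen_chartOverlap p q).mem_nhds hyo)).differentiableAt (by simp)
  -- A ball in the chart target is convex, so a vanishing derivative makes F constant on a
  -- neighbourhood of p.
  have hloc : IsLocallyConstant F := by
    refine (IsLocallyConstant.iff_eventually_eq F).mpr fun p => ?_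
    obtain ⟨r, hr, hball⟩ := Metric.isOpen_iff.mp (isOpen_extChartAt_target (I := I) p) _
      (mem_extChartAt_target p)
    have hc : ∀ᶠ x in nhds p, extChartAt I p x ∈ Metric.ball (extChartAt I p p) r :=
      (continuousAt_extChartAt p).eventually (Metric.ball_mem_nhds _ hr)
    filter_upwards [hc, extChartAt_source_mem_nhds (I := I) p] with x hx hxs
    have := (convex_ball (extChartAt I p p) r).is_const_of_fderivWithin_eq_zero (𝕜 := ℝ)
      (f := F ∘ (extChartAt I p).symm)
      (((hF p).mono hball).differentiableOn (by simp))
      (fun y hy => by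
        rw [fderivWithin_of_isOpen Metric.isOpen_ball hy, hzero p y (hball hy)]) hx
      (Metric.mem_ball_self hr)
    simpa only [Function.comp_apply, (extChartAt I p).left_inv hxs, extChartAt_to_inv] using this
  obtain ⟨x₀⟩ := (inferInstance : Nonempty M)
  exact ⟨F x₀, fun x => hloc.apply_eq_of_preconnectedSpace x x₀⟩

end Charts

/-! ### The warped product manifold and the equivalence -/

section Warped

variable {E : Type*} [NormedAddCommGroup E] [NormedSpace ℝ E] [FiniteDimensional ℝ E]
  {H : Type*} [TopologicalSpace H] {I : ModelWithCorners ℝ E H} [I.Boundaryless]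
  {M : Type*} [TopologicalSpace M] [ChartedSpace H M] [IsManifold I ∞ M]
  {F : Type*} [NormedAddCommGroup F] [NormedSpace ℝ F] [FiniteDimensional ℝ F]
  {K : Type*} [TopologicalSpace K] {J : ModelWithCorners ℝ F K} [J.Boundaryless]
  {N : Type*} [TopologicalSpace N] [ChartedSpace K N] [IsManifold J ∞ N]
  {ι κ : Type*} [Fintype ι] [DecidableEq ι] [Fintype κ] [DecidableEq κ]
  (b : Basis ι ℝ E) (c : Basis κ ℝ F)
  (gM : RiemannianMetricOn I M) (gN : RiemannianMetricOn J N) {f : M → ℝ}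
  (hf : ContMDiff I 𝓘(ℝ, ℝ) ∞ f)

omit [I.Boundaryless] [J.Boundaryless] [IsManifold I ∞ M] [IsManifold J ∞ N]
  [FiniteDimensional ℝ E] [FiniteDimensional ℝ F] in
theorem extChartAt_prod_symm_apply (p : M × N) (z : E × F) :
    (extChartAt (I.prod J) p).symm z
      = ((extChartAt I p.1).symm z.1, (extChartAt J p.2).symm z.2) := by
  rw [extChartAt_prod]
  rfl

omit [FiniteDimensional ℝ E] in
theorem mdifferentiableAt_extChartAt_symm {p : M} {y : E} (hy : y ∈ (extChartAt I p).target) :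
    MDifferentiableAt 𝓘(ℝ, E) I (extChartAt I p).symm y :=
  ((contMDiffOn_extChartAt_symm (n := ∞) p).contMDiffAt
    ((isOpen_extChartAt_target p).mem_nhds hy)).mdifferentiableAt (by simp)

omit [FiniteDimensional ℝ E] [FiniteDimensional ℝ F] in
-- The projection intertwines the inverse product chart with the inverse chart of M; differentiating
-- this equality of maps gives the formula.
theorem fst_chartSymmDeriv (p : M × N) {z : E × F}
    (hz : z ∈ (extChartAt I p.1).target ×ˢ (extChartAt J p.2).target) (v : E × F) :
    (mfderiv (I.prod J) I (Prod.fst : M × N → M) ((extChartAt (I.prod J) p).symm z)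
      (chartSymmDeriv (I.prod J) p z v) : E) = chartSymmDeriv I p.1 z.1 v.1 := by
  have h1 : MDifferentiableAt 𝓘(ℝ, E × F) (I.prod J) (extChartAt (I.prod J) p).symm z :=
    mdifferentiableAt_extChartAt_symm (by rw [extChartAt_prod]; exact hz)
  have h3 : (Prod.fst : M × N → M) ∘ (extChartAt (I.prod J) p).symm
      = (extChartAt I p.1).symm ∘ (Prod.fst : E × F → E) := by
    ext w
    simp only [Function.comp_apply, extChartAt_prod_symm_apply]
  have hA := HasMFDerivAt.comp z (hasMFDerivAt_fst (I := I) (I' := J)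
    (x := (extChartAt (I.prod J) p).symm z)) h1.hasMFDerivAt
  have hB := HasMFDerivAt.comp z (mdifferentiableAt_extChartAt_symm hz.1).hasMFDerivAt
    (hasFDerivAt_fst (𝕜 := ℝ) (p := z)).hasMFDerivAt
  rw [h3] at hA
  rw [mfderiv_fst]
  exact congrArg (fun L : E × F →L[ℝ] E => L v) (hasMFDerivAt_unique hA hB)

omit [FiniteDimensional ℝ E] [FiniteDimensional ℝ F] in
theorem snd_chartSymmDeriv (p : M × N) {z : E × F}
    (hz : z ∈ (extChartAt I p.1).target ×ˢ (extChartAt J p.2).target) (v : E × F) :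
    (mfderiv (I.prod J) J (Prod.snd : M × N → N) ((extChartAt (I.prod J) p).symm z)
      (chartSymmDeriv (I.prod J) p z v) : F) = chartSymmDeriv J p.2 z.2 v.2 := by
  have h1 : MDifferentiableAt 𝓘(ℝ, E × F) (I.prod J) (extChartAt (I.prod J) p).symm z :=
    mdifferentiableAt_extChartAt_symm (by rw [extChartAt_prod]; exact hz)
  have h3 : (Prod.snd : M × N → N) ∘ (extChartAt (I.prod J) p).symm
      = (extChartAt J p.2).symm ∘ (Prod.snd : E × F → F) := by
    ext w
    simp only [Function.comp_apply, extChartAt_prod_symm_apply]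
  have hA := HasMFDerivAt.comp z (hasMFDerivAt_snd (I := I) (I' := J)
    (x := (extChartAt (I.prod J) p).symm z)) h1.hasMFDerivAt
  have hB := HasMFDerivAt.comp z (mdifferentiableAt_extChartAt_symm hz.2).hasMFDerivAt
    (hasFDerivAt_snd (𝕜 := ℝ) (p := z)).hasMFDerivAt
  rw [h3] at hA
  rw [mfderiv_snd]
  exact congrArg (fun L : E × F →L[ℝ] F => L v) (hasMFDerivAt_unique hA hB)

omit [Fintype ι] [DecidableEq ι] [Fintype κ] [DecidableEq κ] in
theorem metricCoord_warpedMetric (p : M × N) :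
    Set.EqOn (metricCoord (b.prod c) (warpedMetric gM gN f hf) p)
      (warpedMatrix (metricCoord b gM p.1) (metricCoord c gN p.2) (f ∘ (extChartAt I p.1).symm))
      ((extChartAt I p.1).target ×ˢ (extChartAt J p.2).target) := by
  intro z hz
  have h : ∀ s t, metricCoord (b.prod c) (warpedMetric gM gN f hf) p z s t
      = modelForm gM ((extChartAt I p.1).symm z.1)
          (chartSymmDeriv I p.1 z.1 (b.prod c s).1) (chartSymmDeriv I p.1 z.1 (b.prod c t).1)
        + Real.exp (2 * f ((extChartAt I p.1).symm z.1)) *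
          modelForm gN ((extChartAt J p.2).symm z.2)
          (chartSymmDeriv J p.2 z.2 (b.prod c s).2)
          (chartSymmDeriv J p.2 z.2 (b.prod c t).2) := fun s t => by
    rw [← fst_chartSymmDeriv p hz, ← fst_chartSymmDeriv p hz, ← snd_chartSymmDeriv p hz,
      ← snd_chartSymmDeriv p hz]
    have h1 : (extChartAt I p.1).symm z.1 = ((extChartAt (I.prod J) p).symm z).1 := by
      rw [extChartAt_prod_symm_apply]
    have h2 : (extChartAt J p.2).symm z.2 = ((extChartAt (I.prod J) p).symm z).2 := by
      rw [extChartAt_prod_symm_apply]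
    rw [h1, h2]
    rfl
  ext s t
  rw [h]
  rcases s with i | i <;> rcases t with j | j <;>
    simp [warpedMatrix, metricCoord_apply]

/-- Everything here lives in the product chart at p, so no coordinate change enters. The nonzero
factor n cancels, and nondegeneracy of the metric trades the gradient for the differential. -/
theorem bitensionField_fst_eq_zero_iff [Nonempty κ] {a : ℝ} (hE : IsEinsteinWith b gM a)
    (p : M × N) :
    bitensionField (b.prod c) (warpedMetric gM gN f hf) b gM (Prod.fst : M × N → M) p = 0 ↔
      fderiv ℝ (potential b (metricCoord b gM p.1) a (Fintype.card κ)
        (f ∘ (extChartAt I p.1).symm)) (extChartAt I p.1 p.1) = 0 := by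
  have hz : (extChartAt I p.1 p.1, extChartAt J p.2 p.2)
      ∈ (extChartAt I p.1).target ×ˢ (extChartAt J p.2).target :=
    ⟨mem_extChartAt_target p.1, mem_extChartAt_target p.2⟩
  have hz' : extChartAt (I.prod J) p p = (extChartAt I p.1 p.1, extChartAt J p.2 p.2) := by
    rw [extChartAt_prod]
    rfl
  have hu : Set.EqOn (writtenInExtChartAt (I.prod J) I p (Prod.fst : M × N → M)) Prod.fst
      ((extChartAt I p.1).target ×ˢ (extChartAt J p.2).target) := fun z hz => by
    simp only [writtenInExtChartAt, Function.comp_apply, extChartAt_prod_symm_apply]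
    exact (extChartAt I p.1).right_inv hz.1
  have hric : ∀ j k, ricci b (metricCoord b gM p.1) j k (extChartAt I p.1 p.1)
      = a * metricCoord b gM p.1 (extChartAt I p.1 p.1) j k := fun j k => by
    rw [metricCoord_apply, chartSymmDeriv_self, extChartAt_to_inv]
    refine Eq.trans ?_ (hE p.1 (b j) (b k))
    simp [ricciTensor, Finsupp.single_apply]
  have hbit := bitension_warped b c (isOpen_extChartAt_target p.1) (isOpen_extChartAt_target p.2)
    (isMetricOn_metricCoord b gM p.1) (isMetricOn_metricCoord c gN p.2)
    (contDiffOn_comp_chart_symm hf p.1) (metricCoord_warpedMetric b c gM gN hf p) hu hz hric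
  rw [← gradVec_eq_zero_iff b ((isMetricOn_metricCoord b gM p.1).det_ne_zero _ hz.1)]
  have hcard : (Fintype.card κ : ℝ) ≠ 0 := Nat.cast_ne_zero.mpr Fintype.card_ne_zero
  rw [← hz'] at hbit
  have hfield : (bitensionField (b.prod c) (warpedMetric gM gN f hf) b gM
      (Prod.fst : M × N → M) p : E)
      = ∑ α, (Fintype.card κ * gradVec b (metricCoord b gM p.1)
        (potential b (metricCoord b gM p.1) a (Fintype.card κ) (f ∘ (extChartAt I p.1).symm)) α
          (extChartAt I p.1 p.1)) • b α :=
    Finset.sum_congr rfl fun α _ => congrArg (fun r : ℝ => r • b α) (hbit α)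
  constructor
  · intro h α
    have h0 := hfield.symm.trans h
    have := Fintype.linearIndependent_iff.mp b.linearIndependent _ h0 α
    exact (mul_eq_zero.mp this).resolve_left hcard
  · intro h
    refine hfield.trans (Finset.sum_eq_zero fun α _ => ?_)
    rw [h α, mul_zero, zero_smul]
    rfl

/-- The projection of a warped product over an Einstein manifold is biharmonic if and only if
`Δf + 2 a f + (n / 2) |grad f|²` is constant. -/
theorem isBiharmonicMap_fst_iff [ConnectedSpace M] [Nonempty N] [Nonempty κ] {a : ℝ}
    (hE : IsEinsteinWith b gM a) :
    IsBiharmonicMap (b.prod c) (warpedMetric gM gN f hf) b gM (Prod.fst : M × N → M) ↔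
      ∃ C, ∀ x, manifoldPotential b gM a (Fintype.card κ) f x = C := by
  have heq := manifoldPotential_eqOn b gM hf a (Fintype.card κ)
  rw [exists_const_iff_fderiv_eq_zero (I := I) fun p =>
    (contDiffOn_potential b (isOpen_extChartAt_target p) (isMetricOn_metricCoord b gM p)
      (contDiffOn_comp_chart_symm hf p) a (Fintype.card κ)).congr (heq p)]
  rw [IsBiharmonicMap, and_iff_right contMDiff_fst]
  -- The condition at (x, y) does not involve y; since N is nonempty, quantifying over y can be
  -- dropped.
  simp only [bitensionField_fst_eq_zero_iff b c gM gN hf hE, Prod.forall, forall_const,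
    fun p : M => fderiv_congr_on (isOpen_extChartAt_target p) (heq p) (mem_extChartAt_target p)]

end Warped

end

theorem mainTheorem5 (m n : ℕ) (hn : 1 ≤ n)
    {M : Type*} [TopologicalSpace M] [ChartedSpace (EuclideanSpace ℝ (Fin m)) M]
    [IsManifold (𝓡 m) ∞ M] [ConnectedSpace M]
    {N : Type*} [TopologicalSpace N] [ChartedSpace (EuclideanSpace ℝ (Fin n)) N]
    [IsManifold (𝓡 n) ∞ N] [Nonempty N]
    (gM : RiemannianMetricOn (𝓡 m) M) (gN : RiemannianMetricOn (𝓡 n) N)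
    (f : M → ℝ) (hf : ContMDiff (𝓡 m) 𝓘(ℝ, ℝ) ∞ f)
    (a : ℝ) (hEinstein : IsEinsteinWith (stdBasis m) gM a) :
    IsBiharmonicMap ((stdBasis m).prod (stdBasis n)) (warpedMetric gM gN f hf)
        (stdBasis m) gM (Prod.fst : M × N → M) ↔
      ∃ C : ℝ, ∀ x : M,
        laplaceBeltrami (stdBasis m) gM f x + 2 * a * f x
          + (n : ℝ) / 2 * gradientNormSq (stdBasis m) gM f x = C := by
  -- This is where n ≥ 1 enters: for n = 0 the factor n in the bitension field could not be
  -- cancelled.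
  have : Nonempty (Fin n) := ⟨⟨0, hn⟩⟩
  have h := isBiharmonicMap_fst_iff (stdBasis m) (stdBasis n) gM gN hf hEinstein
  simpa only [manifoldPotential, Fintype.card_fin] using h
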